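/- **Proposition 1.4.** Let $\gamma\in(1,2]$. Let $s_\gamma:(0,\infty)\to(0,\infty)$ be the continuous density of the spectrally positive $\frac{\gamma-1}{\gamma}$-stable law, that is, the unique continuous, integrable function $(0,\infty)\to(0,\infty)$ (it exists) such that $$\int_0^\infty e^{-\lambda x}s_\gamma(x)\,dx=\exp\bigl(-\gamma\lambda^{\frac{\gamma-1}{\gamma}}\bigr)\qquad\text{for all }\lambda\ge 0 .$$ For $x>0$ set $$\theta(x):=(\gamma-1)x^{-1}s_\gamma(x)-\frac{\gamma-1}{\gamma}\,x^{-1-\frac1\gamma}\int_0^x y^{\frac1\gamma-1}s_\gamma(y)\,dy ,\qquad \theta(0):=0 .$$ Then the following holds. (i) The function $\theta$ is well defined (the integral $\int_0^x y^{\frac1\gamma-1}s_\gamma(y)\,dy$ converges for every $x>0$) and continuous on $[0,\infty)$, $$\int_0^\infty|\theta(x)|\,dx<\infty ,\qquad\text{and}\qquad \int_0^\infty e^{-\lambda x}\theta(x)\,dx=\lambda^{\frac1\gamma}\exp\bigl(-\gamma\lambda^{\frac{\gamma-1}{\gamma}}\bigr)\quad\text{for all }\lambda\ge0 .$$ (ii)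 Let $(S_n)_{n\ge0}$ be the sequence of Zolotarev's coefficients, that is, the unique real sequence (it exists) with $S_0=1$ such that for every integer $N\ge1$, as $x\to0+$, $$\Bigl(2\pi\bigl(1-\tfrac1\gamma\bigr)\Bigr)^{\frac12}x^{\frac{\gamma+1}{2}}e^{1/x^{\gamma-1}}s_\gamma((\gamma-1)x)=1+\sum_{1\le n<N}S_nx^{n(\gamma-1)}+\mathcal O_{N,\gamma}\bigl(x^{N(\gamma-1)}\bigr).$$ Let $(V_n)_{n\ge0}$ be defined recursively by $V_0=1$ and, for all integers $n\ge0$, $$V_{n+1}=S_{n+1}+\Bigl(n-\tfrac12-\tfrac1{\gamma-1}\Bigr)S_n-\Bigl(n-\tfrac12-\tfrac1\gamma\Bigr)V_n .$$ Then for every integer $N\ge1$, as $x\to0+$, $$\Bigl(2\pi\bigl(1-\tfrac1\gamma\bigr)\Bigr)^{\frac12}x^{\frac{\gamma+3}{2}}e^{1/x^{\gamma-1}}\theta((\gamma-1)x)=1+\sum_{1\le n<N}V_nx^{n(\gamma-1)}+\mathcal O_{N,\gamma}\bigl(x^{N(\gamma-1)}\bigr).$$ Here $\mathcal O_{N,\gamma}$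 means that the implied constant and the range of $x$ may depend on $N$ and $\gamma$. -/

import Mathlib

open Set Filter Topology MeasureTheory Asymptotics

noncomputable section

/-- `s`, restricted to `(0, ∞)`, is the continuous density of the spectrally positive
`(γ - 1) / γ`-stable law: a continuous positive function with Laplace transform
`l ↦ exp (-γ l ^ ((γ - 1) / γ))` on `[0, ∞)`. The values of `s` outside `(0, ∞)` are irrelevant. -/
structure IsStableDensity (γ : ℝ) (s : ℝ → ℝ) : Prop where
  continuousOn : ContinuousOn s (Ioi 0)
  pos : ∀ x : ℝ, 0 < x → 0 < s x
  integrableOn : IntegrableOn s (Ioi 0)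
  laplace : ∀ l : ℝ, 0 ≤ l →
    ∫ x in Ioi (0 : ℝ), Real.exp (-l * x) * s x = Real.exp (-γ * l ^ ((γ - 1) / γ))

/-- As `x → 0+`, for every `N ≥ 1`,
`(2π(1 - 1/γ))^{1/2} x^p e^{1/x^{γ-1}} f((γ-1)x)
  = 1 + ∑_{1 ≤ n < N} c_n x^{n(γ-1)} + O(x^{N(γ-1)})`. -/
def HasStableExpansion (γ p : ℝ) (f : ℝ → ℝ) (c : ℕ → ℝ) : Prop :=
  ∀ N : ℕ, 1 ≤ N →
    (fun x : ℝ =>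
      Real.sqrt (2 * Real.pi * (1 - 1 / γ)) * x ^ p * Real.exp (1 / x ^ (γ - 1))
          * f ((γ - 1) * x)
        - (1 + ∑ n ∈ Finset.Ico 1 N, c n * x ^ ((n : ℝ) * (γ - 1))))
      =O[𝓝[>] 0] fun x : ℝ => x ^ ((N : ℝ) * (γ - 1))

/-- `S` is the sequence of Zolotarev's coefficients of the density `s` at `0`, with `S 0 = 1`. -/
def IsZolotarevCoeff (γ : ℝ) (s : ℝ → ℝ) (S : ℕ → ℝ) : Prop :=
  S 0 = 1 ∧ HasStableExpansion γ ((γ + 1) / 2) s S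

/-- The function `θ` built from `s` on `(0, ∞)`, extended by the value `0` at `0`. -/
def stableTheta (γ : ℝ) (s : ℝ → ℝ) (x : ℝ) : ℝ :=
  if 0 < x then
    (γ - 1) * x⁻¹ * s x
      - (γ - 1) / γ * x ^ (-1 - 1 / γ) * ∫ y in Ioc 0 x, y ^ (1 / γ - 1) * s y
  else 0

/-- The sequence `V` defined recursively from `S`. -/
def stableV (γ : ℝ) (S : ℕ → ℝ) : ℕ → ℝ
  | 0 => 1
  | n + 1 => S (n + 1) + ((n : ℝ) - 1 / 2 - 1 / (γ - 1)) * S n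
      - ((n : ℝ) - 1 / 2 - 1 / γ) * stableV γ S n

end

/-!
Write `α = (γ - 1) / γ` and `κ = γ - 1`.

The density is the Bromwich integral of `exp (-γ z ^ α)`, which decays like a stretched exponential
on every vertical line because `α < 1`. Cauchy's theorem makes it independent of the line
(`bromwich_eq`); moving the line shows that it is bounded and vanishes on the negative axis, and
Fourier inversion on the line gives its Laplace transform (`laplace_bromwich`).

Its behaviour at `0+` comes from the line through the saddle point: at the point `κ x`, the line
`Re z = x ^ (-γ)` turns the integral into that of `exp (-u φ(η))` over `ℝ`, with `u = x ^ (-κ)` and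
a phase `φ(η) = η ^ 2 B(η)` whose real part increases with `|η|`. Laplace's method, with Taylor
coefficients given by Cauchy integrals, yields an expansion in powers of `u ^ (-1/2)` whose odd
terms vanish by parity (`exists_laplace_expansion`, `exists_saddle_expansion`); this gives
Zolotarev's coefficients (`exists_isZolotarevCoeff_stableDensity`).

Differentiating the Laplace transform leads to the fractional integral equation
`x s(x) = κ / Γ(1 - α) ∫_0^x s(t) (x - t) ^ (-α) dt`. As `s` is positive near `0` by its expansion,
this equation excludes a first zero (`stableDensity_pos`). Positivity gives integrability and the
total mass by monotone convergence. Uniqueness of the density is uniqueness of Laplace transforms,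
which follows from the analytic continuation of moment generating functions
(`ae_eq_zero_of_laplace_eq_zero`).

The expansion also shows that `s` is flat at `0`, which controls `θ` there. Its Laplace transform
is computed with Tonelli's theorem, an integration by parts, and the primitive of
`v ^ (α - 1) exp (-c v ^ α)` (`IsStableDensity.laplace_stableTheta`). For its expansion, that of
`s` is integrated termwise (`stablePrimitive_expansion`), the remainder being controlled by
comparing derivatives. The coefficients `w n` of the primitive satisfy a two-term recursion, which
under `V (n + 1) = S (n + 1) - w n` is the defining recursion of `V`.
-/

/-! ### The symbol of the stable law and the Bromwich integral -/

/-- The function `z ↦ exp (-γ z ^ α)` on the closed right half-plane, principal branch. -/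
noncomputable def stableSymbol (γ α : ℝ) (z : ℂ) : ℂ := Complex.exp (-(γ : ℂ) * z ^ (α : ℂ))

/-- The Bromwich integral over the line `Re z = c`: the inverse Laplace transform of
`stableSymbol γ α` at `x`. -/
noncomputable def bromwich (γ α c x : ℝ) : ℂ :=
  (1 / (2 * Real.pi) : ℝ) •
    ∫ y : ℝ, Complex.exp ((c + y * Complex.I) * x) * stableSymbol γ α (c + y * Complex.I)

lemma cos_mul_pi_div_two_pos {α : ℝ} (h0 : 0 < α) (h1 : α < 1) :
    0 < Real.cos (α * (Real.pi / 2)) :=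
  Real.cos_pos_of_mem_Ioo ⟨by nlinarith [Real.pi_pos], by nlinarith [Real.pi_pos]⟩

lemma cos_mul_norm_rpow_le_re_cpow {α : ℝ} (h0 : 0 < α) (h1 : α < 1) {z : ℂ} (hz : 0 ≤ z.re) :
    Real.cos (α * (Real.pi / 2)) * ‖z‖ ^ α ≤ (z ^ (α : ℂ)).re := by
  rw [Complex.cpow_ofReal_re, mul_comm]
  gcongr
  rw [← Real.cos_abs (z.arg * α), abs_mul, abs_of_pos h0, mul_comm]
  have := Complex.abs_arg_le_pi_div_two_iff.2 hz
  apply Real.cos_le_cos_of_nonneg_of_le_pi (by positivity)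
  · nlinarith [Real.pi_pos]
  · gcongr

lemma norm_stableSymbol (γ α : ℝ) (z : ℂ) :
    ‖stableSymbol γ α z‖ = Real.exp (-γ * (z ^ (α : ℂ)).re) := by
  simp [stableSymbol, Complex.norm_exp]

lemma norm_stableSymbol_le {γ α : ℝ} (hγ : 0 < γ) (h0 : 0 < α) (h1 : α < 1) {z : ℂ}
    (hz : 0 ≤ z.re) :
    ‖stableSymbol γ α z‖ ≤ Real.exp (-(γ * Real.cos (α * (Real.pi / 2))) * |z.im| ^ α) := by
  rw [norm_stableSymbol, Real.exp_le_exp]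
  have h2 := cos_mul_norm_rpow_le_re_cpow h0 h1 hz
  have h3 : |z.im| ^ α ≤ ‖z‖ ^ α :=
    Real.rpow_le_rpow (abs_nonneg _) (Complex.abs_im_le_norm z) h0.le
  have h4 := cos_mul_pi_div_two_pos h0 h1
  have : Real.cos (α * (Real.pi / 2)) * |z.im| ^ α ≤ (z ^ (α : ℂ)).re :=
    (mul_le_mul_of_nonneg_left h3 h4.le).trans h2
  nlinarith

lemma integrable_exp_neg_mul_abs_rpow {k α : ℝ} (hk : 0 < k) (hα : 0 < α) :
    Integrable fun y : ℝ => Real.exp (-k * |y| ^ α) := by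
  have h : IntegrableOn (fun y : ℝ => Real.exp (-k * |y| ^ α)) (Ioi 0) := by
    refine (integrableOn_rpow_mul_exp_neg_mul_rpow (s := 0) (by norm_num) hα hk).congr_fun
      (fun x hx => ?_) measurableSet_Ioi
    simp [abs_of_pos (mem_Ioi.1 hx)]
  rw [← integrableOn_univ, ← Iic_union_Ioi (a := (0 : ℝ)), integrableOn_union]
  refine ⟨?_, h⟩
  rw [integrableOn_Iic_iff_integrableOn_Iio]
  have := IntegrableOn.comp_neg_Iio (c := (0 : ℝ)) (by simpa using h)
  simpa using this

lemma continuousOn_stableSymbol (γ α : ℝ) : ContinuousOn (stableSymbol γ α) {z | 0 < z.re} := by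
  intro z hz
  have : z ∈ Complex.slitPlane := Or.inl hz
  unfold stableSymbol
  exact ContinuousAt.continuousWithinAt
    (by fun_prop (disch := assumption))

lemma differentiableAt_stableSymbol (γ α : ℝ) {z : ℂ} (hz : 0 < z.re) :
    DifferentiableAt ℂ (stableSymbol γ α) z := by
  have : z ∈ Complex.slitPlane := Or.inl hz
  unfold stableSymbol
  exact (((differentiableAt_id.cpow_const this).const_mul _)).cexp

lemma continuous_stableSymbol_line (γ α : ℝ) {c : ℝ} (hc : 0 < c) :
    Continuous fun y : ℝ => stableSymbol γ α (c + y * Complex.I) := by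
  refine (continuousOn_stableSymbol γ α).comp_continuous (by fun_prop) fun y => ?_
  simpa using hc

lemma integrable_stableSymbol_line {γ α : ℝ} (hγ : 0 < γ) (h0 : 0 < α) (h1 : α < 1) {c : ℝ}
    (hc : 0 < c) : Integrable fun y : ℝ => stableSymbol γ α (c + y * Complex.I) := by
  refine (integrable_exp_neg_mul_abs_rpow
    (mul_pos hγ (cos_mul_pi_div_two_pos h0 h1)) h0).mono'
    (continuous_stableSymbol_line γ α hc).aestronglyMeasurable (.of_forall fun y => ?_)
  simpa using norm_stableSymbol_le hγ h0 h1 (z := c + y * Complex.I) (by simpa using hc.le)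

lemma norm_exp_line (c x y : ℝ) :
    ‖Complex.exp ((c + y * Complex.I) * x)‖ = Real.exp (c * x) := by
  simp [Complex.norm_exp]

lemma integrable_bromwich {γ α : ℝ} (hγ : 0 < γ) (h0 : 0 < α) (h1 : α < 1) {c : ℝ}
    (hc : 0 < c) (x : ℝ) : Integrable fun y : ℝ =>
      Complex.exp ((c + y * Complex.I) * x) * stableSymbol γ α (c + y * Complex.I) := by
  refine (integrable_stableSymbol_line hγ h0 h1 hc).bdd_mul (c := Real.exp (c * x))
    (by fun_prop) (.of_forall fun y => (norm_exp_line c x y).le)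

/-- Cauchy's theorem for a vertical strip. -/
lemma integral_vertical_line_eq {F : ℂ → ℂ} {a b : ℝ} (hab : a ≤ b)
    (hF : ∀ z : ℂ, a ≤ z.re → DifferentiableAt ℂ F z) {g : ℝ → ℝ} (hg : Tendsto g atTop (𝓝 0))
    (hFg : ∀ z : ℂ, a ≤ z.re → z.re ≤ b → ‖F z‖ ≤ g |z.im|)
    (ha : Integrable fun y : ℝ => F (a + y * Complex.I))
    (hb : Integrable fun y : ℝ => F (b + y * Complex.I)) :
    ∫ y : ℝ, F (a + y * Complex.I) = ∫ y : ℝ, F (b + y * Complex.I) := by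
  have ta := intervalIntegral_tendsto_integral ha tendsto_neg_atTop_atBot tendsto_id
  have tb := intervalIntegral_tendsto_integral hb tendsto_neg_atTop_atBot tendsto_id
  have h1 : ∀ T : ℝ, 0 ≤ T → ‖(∫ y in (-T)..T, F (b + y * Complex.I)) -
      ∫ y in (-T)..T, F (a + y * Complex.I)‖ ≤ 2 * (g T * (b - a)) := by
    intro T hT
    have key := Complex.integral_boundary_rect_eq_zero_of_differentiableOn F
      (⟨a, -T⟩ : ℂ) (⟨b, T⟩ : ℂ) (fun z hz => (hF z (by
        have := hz.1
        simp only [uIcc_of_le hab, mem_preimage, mem_Icc] at this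
        exact this.1)).differentiableWithinAt)
    have e1 : ‖∫ x : ℝ in a..b, F (x + (-T : ℝ) * Complex.I)‖ ≤ g T * |b - a| := by
      refine intervalIntegral.norm_integral_le_of_norm_le_const fun x hx => ?_
      rw [uIoc_of_le hab] at hx
      simpa [abs_of_nonneg hT] using
        hFg (x + (-T : ℝ) * Complex.I) (by simpa using hx.1.le) (by simpa using hx.2)
    have e2 : ‖∫ x : ℝ in a..b, F (x + (T : ℝ) * Complex.I)‖ ≤ g T * |b - a| := by
      refine intervalIntegral.norm_integral_le_of_norm_le_const fun x hx => ?_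
      rw [uIoc_of_le hab] at hx
      simpa [abs_of_nonneg hT] using
        hFg (x + T * Complex.I) (by simpa using hx.1.le) (by simpa using hx.2)
    rw [abs_of_nonneg (sub_nonneg.2 hab)] at e1 e2
    simp only [smul_eq_mul] at key
    have : Complex.I * ((∫ y in (-T)..T, F (b + y * Complex.I)) -
        ∫ y in (-T)..T, F (a + y * Complex.I)) =
        (∫ x : ℝ in a..b, F (x + (T : ℝ) * Complex.I)) -
          ∫ x : ℝ in a..b, F (x + (-T : ℝ) * Complex.I) := by
      linear_combination key
    calc _ = ‖Complex.I * ((∫ y in (-T)..T, F (b + y * Complex.I)) -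
        ∫ y in (-T)..T, F (a + y * Complex.I))‖ := by simp
      _ ≤ _ := by
        rw [this]
        exact (norm_sub_le _ _).trans (by linarith)
  have h2 : Tendsto (fun T : ℝ => (∫ y in (-T)..T, F (b + y * Complex.I)) -
      ∫ y in (-T)..T, F (a + y * Complex.I)) atTop (𝓝 0) := by
    refine squeeze_zero_norm' ((eventually_ge_atTop 0).mono h1) ?_
    simpa using (hg.mul_const (b - a)).const_mul 2
  have h3 := tendsto_nhds_unique h2 (tb.sub ta)
  exact (sub_eq_zero.1 h3.symm).symm

lemma tendsto_exp_neg_mul_rpow {k α : ℝ} (hk : 0 < k) (hα : 0 < α) :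
    Tendsto (fun y : ℝ => Real.exp (-k * y ^ α)) atTop (𝓝 0) := by
  refine Real.tendsto_exp_atBot.comp ?_
  exact (tendsto_rpow_atTop hα).const_mul_atTop_of_neg (by linarith)

/-- The Bromwich integral does not depend on the line. -/
lemma bromwich_eq_of_le {γ α : ℝ} (hγ : 0 < γ) (h0 : 0 < α) (h1 : α < 1) {a b : ℝ} (ha : 0 < a)
    (hab : a ≤ b) (x : ℝ) : bromwich γ α a x = bromwich γ α b x := by
  have hk := mul_pos hγ (cos_mul_pi_div_two_pos h0 h1)
  unfold bromwich
  congr 1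
  refine integral_vertical_line_eq
    (F := fun z => Complex.exp (z * x) * stableSymbol γ α z) hab
    (g := fun y => Real.exp (b * |x|) *
      Real.exp (-(γ * Real.cos (α * (Real.pi / 2))) * y ^ α)) ?_ ?_ ?_
    (integrable_bromwich hγ h0 h1 ha x) (integrable_bromwich hγ h0 h1 (ha.trans_le hab) x)
  · intro z hz
    exact ((differentiableAt_id.mul_const _).cexp).mul
      (differentiableAt_stableSymbol γ α (ha.trans_le hz))
  · simpa using (tendsto_exp_neg_mul_rpow hk h0).const_mul (Real.exp (b * |x|))
  · intro z hz hz'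
    rw [norm_mul]
    gcongr
    · simp only [Complex.norm_exp, Complex.mul_re, Complex.ofReal_re, Complex.ofReal_im,
        mul_zero, sub_zero, Real.exp_le_exp]
      calc z.re * x ≤ |z.re * x| := le_abs_self _
        _ = z.re * |x| := by rw [abs_mul, abs_of_pos (ha.trans_le hz)]
        _ ≤ b * |x| := by gcongr
    · exact norm_stableSymbol_le hγ h0 h1 (ha.le.trans hz)

lemma bromwich_eq {γ α : ℝ} (hγ : 0 < γ) (h0 : 0 < α) (h1 : α < 1) {a b : ℝ} (ha : 0 < a)
    (hb : 0 < b) (x : ℝ) : bromwich γ α a x = bromwich γ α b x := by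
  rcases le_total a b with h | h
  · exact bromwich_eq_of_le hγ h0 h1 ha h x
  · exact (bromwich_eq_of_le hγ h0 h1 hb h x).symm

lemma exists_norm_bromwich_le {γ α : ℝ} (hγ : 0 < γ) (h0 : 0 < α) (h1 : α < 1) :
    ∃ K : ℝ, ∀ c x : ℝ, 0 < c → ‖bromwich γ α c x‖ ≤ Real.exp (c * x) * K := by
  have hi := integrable_exp_neg_mul_abs_rpow (mul_pos hγ (cos_mul_pi_div_two_pos h0 h1)) h0
  refine ⟨1 / (2 * Real.pi) *
    ∫ y : ℝ, Real.exp (-(γ * Real.cos (α * (Real.pi / 2))) * |y| ^ α), fun c x hc => ?_⟩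
  unfold bromwich
  rw [norm_smul, Real.norm_of_nonneg (by positivity), mul_left_comm, ← integral_const_mul]
  gcongr
  refine norm_integral_le_of_norm_le (hi.const_mul _) (.of_forall fun y => ?_)
  rw [norm_mul, norm_exp_line]
  gcongr
  simpa using norm_stableSymbol_le hγ h0 h1 (z := c + y * Complex.I) (by simpa using hc.le)

/-- Letting the line tend to the imaginary axis removes the factor `exp (c * x)`. -/
lemma exists_norm_bromwich_le_const {γ α : ℝ} (hγ : 0 < γ) (h0 : 0 < α) (h1 : α < 1) :
    ∃ K : ℝ, ∀ c x : ℝ, 0 < c → ‖bromwich γ α c x‖ ≤ K := by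
  obtain ⟨K, hK⟩ := exists_norm_bromwich_le hγ h0 h1
  refine ⟨K, fun c x hc => ?_⟩
  have : Tendsto (fun d : ℝ => Real.exp (d * x) * K) (𝓝[>] 0) (𝓝 (Real.exp (0 * x) * K)) :=
    ((by fun_prop : Continuous fun d : ℝ => Real.exp (d * x) * K).tendsto 0).mono_left
      nhdsWithin_le_nhds
  simp only [zero_mul, Real.exp_zero, one_mul] at this
  refine ge_of_tendsto this ?_
  filter_upwards [self_mem_nhdsWithin] with d hd
  rw [bromwich_eq hγ h0 h1 hc hd]
  exact hK d x hd

/-- For `x < 0` the factor `exp (c * x)` vanishes as the line tends to `+∞`. -/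
lemma bromwich_eq_zero_of_neg {γ α : ℝ} (hγ : 0 < γ) (h0 : 0 < α) (h1 : α < 1) {c x : ℝ}
    (hc : 0 < c) (hx : x < 0) : bromwich γ α c x = 0 := by
  obtain ⟨K, hK⟩ := exists_norm_bromwich_le hγ h0 h1
  have : Tendsto (fun d : ℝ => Real.exp (d * x) * K) atTop (𝓝 0) := by
    have h := (Real.tendsto_exp_atBot.comp (tendsto_id.atTop_mul_const_of_neg hx)).mul_const K
    simpa [Function.comp_def] using h
  rw [← norm_le_zero_iff]
  refine ge_of_tendsto this ?_
  filter_upwards [eventually_gt_atTop 0] with d hd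
  rw [bromwich_eq hγ h0 h1 hc hd]
  exact hK d x hd

lemma continuous_bromwich {γ α : ℝ} (hγ : 0 < γ) (h0 : 0 < α) (h1 : α < 1) {c : ℝ}
    (hc : 0 < c) : Continuous (bromwich γ α c) := by
  have h : bromwich γ α c = fun x : ℝ => Complex.exp (c * x) * ((1 / (2 * Real.pi) : ℝ) •
      ∫ y : ℝ, Complex.exp (y * Complex.I * x) * stableSymbol γ α (c + y * Complex.I)) := by
    ext x
    rw [bromwich, mul_smul_comm, ← integral_const_mul]
    congr 2 with y
    rw [← mul_assoc, ← Complex.exp_add]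
    ring_nf
  rw [h]
  refine Continuous.mul (by fun_prop) (Continuous.fun_const_smul ?_ _)
  refine continuous_of_dominated (bound := fun y => ‖stableSymbol γ α (c + y * Complex.I)‖)
    (fun x => ?_) (fun x => .of_forall fun y => ?_)
    (integrable_stableSymbol_line hγ h0 h1 hc).norm (.of_forall fun y => by fun_prop)
  · exact (((by fun_prop : Continuous fun y : ℝ => Complex.exp (y * Complex.I * x))).mul
      (continuous_stableSymbol_line γ α hc)).aestronglyMeasurable
  · rw [norm_mul]
    simp [Complex.norm_exp]

lemma integrableOn_exp_mul_bromwich {γ α : ℝ} (hγ : 0 < γ) (h0 : 0 < α) (h1 : α < 1) {c l : ℝ}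
    (hc : 0 < c) (hl : 0 < l) :
    IntegrableOn (fun x : ℝ => Complex.exp (-l * x) * bromwich γ α c x) (Ioi 0) := by
  obtain ⟨K, hK⟩ := exists_norm_bromwich_le_const hγ h0 h1
  have h2 : IntegrableOn (fun x : ℝ => Complex.exp (-l * x)) (Ioi 0) := by
    have := (integrableOn_exp_mul_Ioi (a := -l) (by linarith) 0).ofReal (𝕜 := ℂ)
    simpa [IntegrableOn] using this
  refine h2.mul_bdd (c := K) ?_ ?_
  · exact (continuous_bromwich hγ h0 h1 hc).aestronglyMeasurable
  · exact .of_forall fun x => hK c x hc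

/-- The Laplace transform of the Bromwich integral, by Fourier inversion on the line. -/
lemma laplace_bromwich {γ α : ℝ} (hγ : 0 < γ) (h0 : 0 < α) (h1 : α < 1) {c l : ℝ}
    (hc : 0 < c) (hl : 0 < l) :
    ∫ x in Ioi (0 : ℝ), Complex.exp (-l * x) * bromwich γ α c x = stableSymbol γ α l := by
  set f : ℝ → ℂ := fun v => stableSymbol γ α (l + (2 * Real.pi * v : ℝ) * Complex.I) with hf
  have hfc : Continuous f := (continuous_stableSymbol_line γ α hl).comp (by fun_prop)
  have hfi : Integrable f :=
    (integrable_stableSymbol_line hγ h0 h1 hl).comp_mul_left' (R := 2 * Real.pi) (by positivity)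
  -- moving the line to `Re z = l` makes the Bromwich integral an inverse Fourier transform
  have hinv : ∀ x : ℝ, FourierTransformInv.fourierInv f x
      = Complex.exp (-l * x) * bromwich γ α c x := by
    intro x
    rw [bromwich_eq hγ h0 h1 hc hl, bromwich, Real.fourierInv_eq', mul_smul_comm,
      ← integral_const_mul]
    have := Measure.integral_comp_mul_left (fun y : ℝ => Complex.exp (-l * x) *
      (Complex.exp ((l + y * Complex.I) * x) * stableSymbol γ α (l + y * Complex.I)))
      (2 * Real.pi)
    rw [abs_of_pos (by positivity), ← one_div] at this
    rw [← this]
    congr 1 with v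
    rw [← mul_assoc, ← Complex.exp_add, hf, smul_eq_mul]
    congr 2
    simp
    ring
  have hii : Integrable (fun x : ℝ => Complex.exp (-l * x) * bromwich γ α c x) := by
    rw [← integrableOn_univ, ← Iic_union_Ioi (a := (0 : ℝ)), integrableOn_union]
    refine ⟨?_, integrableOn_exp_mul_bromwich hγ h0 h1 hc hl⟩
    rw [integrableOn_Iic_iff_integrableOn_Iio]
    refine integrableOn_zero.congr_fun (fun x hx => ?_) measurableSet_Iio
    simp [bromwich_eq_zero_of_neg hγ h0 h1 hc (mem_Iio.1 hx)]
  have hff : Integrable (FourierTransform.fourier f) := by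
    have : FourierTransform.fourier f
        = fun x => (fun x : ℝ => Complex.exp (-l * x) * bromwich γ α c x) (-x) := by
      ext x
      simp only [← hinv, Real.fourierInv_eq_fourier_neg, neg_neg]
    rw [this]
    exact hii.comp_neg
  have key := congrFun (hfc.fourier_fourierInv_eq hfi hff) 0
  rw [Real.fourier_real_eq] at key
  simp only [mul_zero, neg_zero, hinv] at key
  have e : f 0 = stableSymbol γ α l := by simp [hf]
  rw [← e, ← key]
  simp only [AddChar.map_zero_eq_one, one_smul]
  rw [← intervalIntegral.integral_Iic_add_Ioi hii.integrableOn hii.integrableOn (b := 0),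
    integral_Iic_eq_integral_Iio, setIntegral_eq_zero_of_forall_eq_zero (t := Iio 0), zero_add]
  intro x hx
  simp [bromwich_eq_zero_of_neg hγ h0 h1 hc (mem_Iio.1 hx)]

/-! ### Uniqueness of Laplace transforms -/

/-- Two finite measures whose moment generating functions are finite and equal on `(-∞, b)`,
`b > 0`, coincide: the moment generating functions extend analytically to a half-plane
containing the imaginary axis. -/
lemma measure_ext_of_mgf_eqOn_Iio {μ ν : Measure ℝ} [IsFiniteMeasure μ] [IsFiniteMeasure ν]
    {b : ℝ} (hb : 0 < b) (hμ : ∀ t < b, Integrable (fun x => Real.exp (t * x)) μ)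
    (hν : ∀ t < b, Integrable (fun x => Real.exp (t * x)) ν)
    (h : ∀ t < b, ∫ x, Real.exp (t * x) ∂μ = ∫ x, Real.exp (t * x) ∂ν) : μ = ν := by
  have hint : ∀ {ρ : Measure ℝ}, (∀ t < b, Integrable (fun x => Real.exp (t * x)) ρ) →
      {z : ℂ | z.re < b} ⊆ {z | z.re ∈ interior (ProbabilityTheory.integrableExpSet id ρ)} := by
    intro ρ hρ z hz
    have : Iio b ⊆ ProbabilityTheory.integrableExpSet id ρ := fun t ht => hρ t ht
    exact interior_maximal this isOpen_Iio hz
  have hX : AnalyticOnNhd ℂ (ProbabilityTheory.complexMGF id μ) {z : ℂ | z.re < b} :=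
    ProbabilityTheory.analyticOnNhd_complexMGF.mono (hint hμ)
  have hY : AnalyticOnNhd ℂ (ProbabilityTheory.complexMGF id ν) {z : ℂ | z.re < b} :=
    ProbabilityTheory.analyticOnNhd_complexMGF.mono (hint hν)
  have heq : EqOn (ProbabilityTheory.complexMGF id μ) (ProbabilityTheory.complexMGF id ν)
      {z : ℂ | z.re < b} := by
    refine AnalyticOnNhd.eqOn_of_preconnected_of_frequently_eq hX hY
      ((convex_Iio b).linear_preimage Complex.reLm).isPreconnected (z₀ := 0) (by simpa using hb) ?_
    have h_real : ∃ᶠ x : ℝ in 𝓝[≠] 0,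
        ProbabilityTheory.complexMGF id μ x = ProbabilityTheory.complexMGF id ν x := by
      refine Eventually.frequently ?_
      filter_upwards [mem_nhdsWithin_of_mem_nhds (Iio_mem_nhds hb)] with x hx
      rw [ProbabilityTheory.complexMGF_ofReal, ProbabilityTheory.complexMGF_ofReal]
      simp only [ProbabilityTheory.mgf, id]
      rw [h x hx]
    have ht : Tendsto (fun x : ℝ => (x : ℂ)) (𝓝[≠] 0) (𝓝[≠] 0) := by
      refine tendsto_nhdsWithin_of_tendsto_nhds_of_eventually_within _ ?_ ?_
      · exact (Complex.continuous_ofReal.tendsto' 0 0 (by simp)).mono_left nhdsWithin_le_nhds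
      · filter_upwards [self_mem_nhdsWithin] with x hx
        simpa using hx
    exact ht.frequently h_real
  refine Measure.ext_of_charFun (funext fun t => ?_)
  have := heq (x := (t : ℂ) * Complex.I) (by simpa using hb)
  simp only [ProbabilityTheory.complexMGF, id] at this
  rw [charFun_apply_real, charFun_apply_real]
  convert this using 3 <;> ring_nf

/-- A function with vanishing Laplace transform vanishes almost everywhere. The measures whose
densities are the positive and negative parts of `exp (-2 * x) * D x` have the same moment
generating function on `(-∞, 1)`. -/
lemma ae_eq_zero_of_laplace_eq_zero {D : ℝ → ℝ}
    (hD : IntegrableOn (fun x => Real.exp (-x) * D x) (Ioi 0))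
    (h : ∀ l : ℝ, 1 < l → ∫ x in Ioi (0 : ℝ), Real.exp (-l * x) * D x = 0) :
    ∀ᵐ x ∂volume.restrict (Ioi (0 : ℝ)), D x = 0 := by
  have hint : ∀ l : ℝ, 1 ≤ l → IntegrableOn (fun x => Real.exp (-l * x) * D x) (Ioi 0) := by
    intro l hl
    have h2 : IntegrableOn (fun x => Real.exp (-(l - 1) * x) * (Real.exp (-x) * D x)) (Ioi 0) := by
      refine Integrable.bdd_mul (c := 1) hD (by fun_prop) ?_
      filter_upwards [ae_restrict_mem measurableSet_Ioi] with x hx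
      rw [Real.norm_of_nonneg (Real.exp_pos _).le, Real.exp_le_one_iff]
      have : (0 : ℝ) < x := hx
      nlinarith
    refine h2.congr_fun (fun x _ => ?_) measurableSet_Ioi
    simp only
    rw [← mul_assoc, ← Real.exp_add]
    ring_nf
  set E : ℝ → ℝ := fun x => Real.exp (-2 * x) * D x with hE
  have hEi : Integrable E (volume.restrict (Ioi 0)) := hint 2 (by norm_num)
  set m := volume.restrict (Ioi (0 : ℝ)) with hm
  set μ := m.withDensity fun x => ENNReal.ofReal (E x) with hμ
  set ν := m.withDensity fun x => ENNReal.ofReal (-E x) with hν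
  have : IsFiniteMeasure μ := isFiniteMeasure_withDensity_ofReal hEi.2
  have : IsFiniteMeasure ν := isFiniteMeasure_withDensity_ofReal hEi.neg.2
  have hmE : AEMeasurable E m := hEi.aemeasurable
  have hmE' : AEMeasurable (fun x => -E x) m := hmE.neg
  have ha : ∀ t x : ℝ, Real.exp (t * x) * E x = Real.exp (-(2 - t) * x) * D x := by
    intro t x
    rw [hE, ← mul_assoc, ← Real.exp_add]
    ring_nf
  have hEt : ∀ t < 1, Integrable (fun x => Real.exp (t * x) * E x) m := by
    intro t ht
    simp_rw [ha]
    exact hint (2 - t) (by linarith)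
  have hp : ∀ t < 1, Integrable (fun x => max (E x) 0 * Real.exp (t * x)) m := by
    intro t ht
    refine (hEt t ht).mono (by fun_prop) (.of_forall fun x => ?_)
    rw [norm_mul, norm_mul, mul_comm]
    gcongr
    simp only [Real.norm_eq_abs]
    rw [abs_of_nonneg (le_max_right _ _)]
    exact max_le (le_abs_self _) (abs_nonneg _)
  have hn : ∀ t < 1, Integrable (fun x => max (-E x) 0 * Real.exp (t * x)) m := by
    intro t ht
    refine (hEt t ht).mono (by fun_prop) (.of_forall fun x => ?_)
    rw [norm_mul, norm_mul, mul_comm]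
    gcongr
    simp only [Real.norm_eq_abs]
    rw [abs_of_nonneg (le_max_right _ _)]
    exact max_le (neg_le_abs _) (abs_nonneg _)
  have key : μ = ν := by
    refine measure_ext_of_mgf_eqOn_Iio one_pos (fun t ht => ?_) (fun t ht => ?_) (fun t ht => ?_)
    · rw [hμ, integrable_withDensity_iff_integrable_smul₀' hmE.ennreal_ofReal (by simp)]
      simpa [ENNReal.toReal_ofReal'] using hp t ht
    · rw [hν, integrable_withDensity_iff_integrable_smul₀' hmE'.ennreal_ofReal (by simp)]
      simpa [ENNReal.toReal_ofReal'] using hn t ht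
    · rw [hμ, hν, integral_withDensity_eq_integral_toReal_smul₀ hmE.ennreal_ofReal (by simp),
        integral_withDensity_eq_integral_toReal_smul₀ hmE'.ennreal_ofReal (by simp)]
      simp only [ENNReal.toReal_ofReal', smul_eq_mul]
      rw [← sub_eq_zero, ← integral_sub (hp t ht) (hn t ht)]
      have := h (2 - t) (by linarith)
      refine Eq.trans (integral_congr_ae (.of_forall fun x => ?_)) this
      simp only
      rw [← ha, ← sub_mul, mul_comm]
      congr 1
      rcases le_total (E x) 0 with h' | h'
      · rw [max_eq_right h', max_eq_left (by linarith)]; ring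
      · rw [max_eq_left h', max_eq_right (by linarith)]; ring
  have h3 := (withDensity_eq_iff hmE.ennreal_ofReal hmE'.ennreal_ofReal
    hEi.lintegral_lt_top.ne).1 key
  filter_upwards [h3] with x hx
  have hx' : E x = 0 := by
    rcases le_total (E x) 0 with h' | h'
    · have : -E x ≤ 0 := by
        rw [← ENNReal.ofReal_eq_zero, ← hx, ENNReal.ofReal_eq_zero]; exact h'
      linarith
    · have : E x ≤ 0 := by
        rw [← ENNReal.ofReal_eq_zero, hx, ENNReal.ofReal_eq_zero]; linarith
      linarith
  simpa [hE] using hx'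

lemma IsStableDensity.eqOn {γ : ℝ} {s t : ℝ → ℝ} (hs : IsStableDensity γ s)
    (ht : IsStableDensity γ t) : EqOn t s (Ioi 0) := by
  have hi : ∀ {u : ℝ → ℝ}, IsStableDensity γ u → ∀ l : ℝ, 0 ≤ l →
      IntegrableOn (fun x => Real.exp (-l * x) * u x) (Ioi 0) := by
    intro u hu l hl
    refine Integrable.bdd_mul (c := 1) hu.integrableOn (by fun_prop) ?_
    filter_upwards [ae_restrict_mem measurableSet_Ioi] with x hx
    rw [Real.norm_of_nonneg (Real.exp_pos _).le, Real.exp_le_one_iff]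
    have : (0 : ℝ) < x := hx
    nlinarith
  have h := ae_eq_zero_of_laplace_eq_zero (D := fun x => t x - s x) ?_ ?_
  · refine Measure.eqOn_open_of_ae_eq (μ := volume) ?_ isOpen_Ioi ht.continuousOn hs.continuousOn
    filter_upwards [h] with x hx
    linarith
  · simp only [mul_sub]
    have := (hi ht 1 zero_le_one).sub (hi hs 1 zero_le_one)
    simpa [Pi.sub_def] using this
  · intro l hl
    simp only [mul_sub]
    rw [integral_sub (hi ht l (by linarith)) (hi hs l (by linarith)),
      ht.laplace l (by linarith), hs.laplace l (by linarith), sub_self]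

/-! ### Laplace's method -/

/-- The `k`-th Taylor coefficient at `φ = 0` of `φ ↦ exp (-ψ ^ 2 * B φ)`, as a Cauchy integral. -/
noncomputable def gaussianTaylorCoeff (B : ℂ → ℂ) (r : ℝ) (k : ℕ) (ψ : ℝ) : ℂ :=
  (2 * Real.pi * Complex.I : ℂ)⁻¹ •
    ∮ z in C(0, r), Complex.exp (-ψ ^ 2 * B z) * (z ^ (k + 1))⁻¹

lemma norm_exp_neg_sq_mul_le {b : ℝ} {w : ℂ} (hw : b ≤ w.re) (ψ : ℝ) :
    ‖Complex.exp (-ψ ^ 2 * w)‖ ≤ Real.exp (-b * ψ ^ 2) := by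
  have : (-(ψ : ℂ) ^ 2 * w).re = -ψ ^ 2 * w.re := by
    rw [← Complex.ofReal_pow, ← Complex.ofReal_neg, Complex.re_ofReal_mul]
  rw [Complex.norm_exp, this, Real.exp_le_exp]
  nlinarith [sq_nonneg ψ]

section

variable {B : ℂ → ℂ} {r b : ℝ}

lemma norm_gaussianTaylorCoeff_le (hr : 0 < r)
    (hre : ∀ z ∈ Metric.closedBall (0 : ℂ) r, b ≤ (B z).re) (k : ℕ) (ψ : ℝ) :
    ‖gaussianTaylorCoeff B r k ψ‖ ≤ Real.exp (-b * ψ ^ 2) / r ^ k := by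
  have := circleIntegral.norm_two_pi_i_inv_smul_integral_le_of_norm_le_const
    (f := fun z => Complex.exp (-ψ ^ 2 * B z) * (z ^ (k + 1))⁻¹) (c := 0) (R := r)
    (C := Real.exp (-b * ψ ^ 2) * (r ^ (k + 1))⁻¹) hr.le (fun z hz => by
      rw [norm_mul, norm_inv, norm_pow, mem_sphere_zero_iff_norm.1 hz]
      gcongr
      exact norm_exp_neg_sq_mul_le (hre z (Metric.sphere_subset_closedBall hz)) ψ)
  refine this.trans (le_of_eq ?_)
  field_simp
  ring

lemma continuous_gaussianTaylorCoeff (hr : 0 < r)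
    (hB : ContinuousOn B (Metric.closedBall 0 r)) (k : ℕ) :
    Continuous (gaussianTaylorCoeff B r k) := by
  unfold gaussianTaylorCoeff circleIntegral
  have hBc : Continuous fun θ : ℝ => B (circleMap 0 r θ) :=
    hB.comp_continuous (continuous_circleMap 0 r) fun θ =>
      circleMap_mem_closedBall 0 hr.le θ
  refine Continuous.fun_const_smul ?_ _
  refine intervalIntegral.continuous_parametric_intervalIntegral_of_continuous' ?_ 0 (2 * Real.pi)
  have h0 : ∀ θ : ℝ, circleMap 0 r θ ^ (k + 1) ≠ 0 := fun θ =>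
    pow_ne_zero _ (circleMap_ne_center hr.ne')
  have hBc' : Continuous fun p : ℝ × ℝ => B (circleMap 0 r p.2) := hBc.comp continuous_snd
  have hcm : Continuous fun p : ℝ × ℝ => circleMap 0 r p.2 :=
    (continuous_circleMap 0 r).comp continuous_snd
  simp only [deriv_circleMap, Function.uncurry_def]
  have h1 : Continuous fun p : ℝ × ℝ => (circleMap 0 r p.2 ^ (k + 1))⁻¹ :=
    (hcm.pow _).inv₀ fun p => h0 p.2
  have h2 : Continuous fun p : ℝ × ℝ =>
      Complex.exp (-(p.1 : ℂ) ^ 2 * B (circleMap 0 r p.2)) :=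
    Complex.continuous_exp.comp
      (((Complex.continuous_ofReal.comp continuous_fst).pow 2).neg.mul hBc')
  exact (hcm.mul continuous_const).smul (h2.mul h1)

lemma gaussianTaylorCoeff_neg (k : ℕ) (ψ : ℝ) :
    gaussianTaylorCoeff B r k (-ψ) = gaussianTaylorCoeff B r k ψ := by
  simp [gaussianTaylorCoeff]

lemma gaussianTaylorCoeff_zero (hr : 0 < r)
    (hB : DifferentiableOn ℂ B (Metric.closedBall 0 r)) (ψ : ℝ) :
    gaussianTaylorCoeff B r 0 ψ = Complex.exp (-ψ ^ 2 * B 0) := by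
  have hd : DifferentiableOn ℂ (fun z => Complex.exp (-ψ ^ 2 * B z)) (Metric.closedBall 0 r) :=
    (hB.const_mul _).cexp
  have hdc := (hd.mono Metric.closure_ball_subset_closedBall).diffContOnCl
  have := hdc.two_pi_i_inv_smul_circleIntegral_sub_inv_smul
    (Metric.mem_ball_self hr)
  rw [← this, gaussianTaylorCoeff]
  simp [mul_comm]

/-- Taylor's formula with a remainder that keeps the Gaussian decay in `ψ`. -/
lemma norm_exp_sub_sum_gaussianTaylorCoeff_le (hr : 0 < r)
    (hB : DifferentiableOn ℂ B (Metric.closedBall 0 r))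
    (hre : ∀ z ∈ Metric.closedBall (0 : ℂ) r, b ≤ (B z).re) (K : ℕ) (ψ : ℝ) {φ : ℂ}
    (hφ : ‖φ‖ ≤ r / 2) :
    ‖Complex.exp (-ψ ^ 2 * B φ) - ∑ k ∈ Finset.range K, φ ^ k * gaussianTaylorCoeff B r k ψ‖
      ≤ 2 * (‖φ‖ / r) ^ K * Real.exp (-b * ψ ^ 2) := by
  set H : ℂ → ℂ := fun z => Complex.exp (-ψ ^ 2 * B z) with hH
  have hd : DifferentiableOn ℂ H (Metric.closedBall 0 r) := (hB.const_mul _).cexp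
  have hcs : ContinuousOn H (Metric.sphere 0 r) :=
    hd.continuousOn.mono Metric.sphere_subset_closedBall
  have hz0 : ∀ z ∈ Metric.sphere (0 : ℂ) r, z ≠ 0 := by
    intro z hz h
    rw [mem_sphere_zero_iff_norm, h, norm_zero] at hz
    exact hr.ne hz
  have hzφ : ∀ z ∈ Metric.sphere (0 : ℂ) r, r / 2 ≤ ‖z - φ‖ := by
    intro z hz
    have := norm_sub_norm_le z φ
    rw [mem_sphere_zero_iff_norm.1 hz] at this
    linarith
  have hzφ0 : ∀ z ∈ Metric.sphere (0 : ℂ) r, z - φ ≠ 0 := fun z hz h => by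
    have := hzφ z hz
    rw [h, norm_zero] at this
    linarith
  -- the remainder of order `K`, divided by `φ ^ K`
  set R : ℕ → ℂ := fun K => (2 * Real.pi * Complex.I : ℂ)⁻¹ •
    ∮ z in C(0, r), H z * (z ^ K * (z - φ))⁻¹ with hR
  have hR0 : R 0 = H φ := by
    have hdc := (hd.mono Metric.closure_ball_subset_closedBall).diffContOnCl
    have := hdc.two_pi_i_inv_smul_circleIntegral_sub_inv_smul
      (w := φ) (by rw [Metric.mem_ball, dist_zero_right]; linarith)
    rw [← this, hR]
    simp [mul_comm]
  have hRs : ∀ K, R K = gaussianTaylorCoeff B r K ψ + φ * R (K + 1) := by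
    intro K
    have i1 : CircleIntegrable (fun z => H z * (z ^ (K + 1))⁻¹) 0 r :=
      ContinuousOn.circleIntegrable hr.le
        (hcs.mul ((continuousOn_id.pow _).inv₀ fun z hz => pow_ne_zero _ (hz0 z hz)))
    have i2 : CircleIntegrable (fun z => φ * (H z * (z ^ (K + 1) * (z - φ))⁻¹)) 0 r :=
      ContinuousOn.circleIntegrable hr.le (continuousOn_const.mul
        (hcs.mul (((continuousOn_id.pow _).mul (continuousOn_id.sub continuousOn_const)).inv₀
          fun z hz => mul_ne_zero (pow_ne_zero _ (hz0 z hz)) (hzφ0 z hz))))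
    rw [hR, gaussianTaylorCoeff]
    simp only
    rw [mul_smul_comm, ← smul_add, ← circleIntegral.integral_const_mul,
      ← circleIntegral.integral_add i1 i2]
    congr 1
    refine circleIntegral.integral_congr hr.le fun z hz => ?_
    have e1 := hz0 z hz
    have e2 := hzφ0 z hz
    field_simp
    simp only [hH]
    ring_nf
  have hsum : ∀ K, H φ - ∑ k ∈ Finset.range K, φ ^ k * gaussianTaylorCoeff B r k ψ
      = φ ^ K * R K := by
    intro K
    induction K with
    | zero => simp [hR0]
    | succ K ih =>
      rw [Finset.sum_range_succ, ← sub_sub, ih, hRs K]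
      ring
  have hRn : ‖R K‖ ≤ r * (Real.exp (-b * ψ ^ 2) * (r ^ K * (r / 2))⁻¹) := by
    refine circleIntegral.norm_two_pi_i_inv_smul_integral_le_of_norm_le_const hr.le fun z hz => ?_
    rw [norm_mul, norm_inv, norm_mul, norm_pow, mem_sphere_zero_iff_norm.1 hz]
    gcongr
    · exact norm_exp_neg_sq_mul_le (hre z (Metric.sphere_subset_closedBall hz)) ψ
    · exact hzφ z hz
  rw [hsum K, norm_mul, norm_pow]
  calc ‖φ‖ ^ K * ‖R K‖ ≤ ‖φ‖ ^ K * (r * (Real.exp (-b * ψ ^ 2) * (r ^ K * (r / 2))⁻¹)) := by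
        gcongr
    _ = _ := by
        rw [div_pow]
        field_simp

lemma integrable_abs_pow_mul_exp_neg_mul_sq (hb : 0 < b) (k : ℕ) :
    Integrable fun ψ : ℝ => |ψ| ^ k * Real.exp (-b * ψ ^ 2) := by
  have := (integrable_rpow_mul_exp_neg_mul_sq hb (s := k) (by
    have : (0 : ℝ) ≤ k := k.cast_nonneg
    linarith)).norm
  simpa [abs_mul, abs_pow] using this

lemma integrable_pow_mul_gaussianTaylorCoeff (hr : 0 < r) (hb : 0 < b)
    (hB : ContinuousOn B (Metric.closedBall 0 r))
    (hre : ∀ z ∈ Metric.closedBall (0 : ℂ) r, b ≤ (B z).re) (k : ℕ) :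
    Integrable fun ψ : ℝ => (ψ : ℂ) ^ k * gaussianTaylorCoeff B r k ψ := by
  refine ((integrable_abs_pow_mul_exp_neg_mul_sq hb k).div_const (r ^ k)).mono' ?_
    (.of_forall fun ψ => ?_)
  · exact (Continuous.mul (by fun_prop)
      (continuous_gaussianTaylorCoeff hr hB k)).aestronglyMeasurable
  · rw [norm_mul, norm_pow, Complex.norm_real, Real.norm_eq_abs, mul_div_assoc]
    gcongr
    exact norm_gaussianTaylorCoeff_le hr hre k ψ

/-- Laplace's method: the rescaled integral has an asymptotic expansion in powers of `ε`, and the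
odd coefficients vanish, being integrals of odd functions of `ψ`. -/
lemma exists_laplace_expansion (hr : 0 < r) (hb : 0 < b)
    (hB : DifferentiableOn ℂ B (Metric.closedBall 0 r))
    (hre : ∀ z ∈ Metric.closedBall (0 : ℂ) r, b ≤ (B z).re) :
    ∃ c : ℕ → ℂ, c 0 = ∫ ψ : ℝ, Complex.exp (-ψ ^ 2 * B 0) ∧ (∀ k, Odd k → c k = 0) ∧
      ∀ K : ℕ, ∃ M : ℝ, ∀ ε : ℝ, 0 < ε →
        ‖(∫ ψ in Icc (-(r / 2 / ε)) (r / 2 / ε), Complex.exp (-ψ ^ 2 * B (ε * ψ)))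
          - ∑ k ∈ Finset.range K, c k * ε ^ k‖ ≤ M * ε ^ K := by
  refine ⟨fun k => ∫ ψ : ℝ, (ψ : ℂ) ^ k * gaussianTaylorCoeff B r k ψ, ?_, ?_, ?_⟩
  · simp [gaussianTaylorCoeff_zero hr hB]
  · intro k hk
    have h := integral_neg_eq_self (fun ψ : ℝ => (ψ : ℂ) ^ k * gaussianTaylorCoeff B r k ψ) volume
    simp only [gaussianTaylorCoeff_neg, Complex.ofReal_neg, hk.neg_pow, neg_mul,
      integral_neg] at h
    exact self_eq_neg.1 h.symm
  · intro K
    refine ⟨(2 + K * 2 ^ K) / r ^ K * ∫ ψ : ℝ, |ψ| ^ K * Real.exp (-b * ψ ^ 2), fun ε hε => ?_⟩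
    set I := Icc (-(r / 2 / ε)) (r / 2 / ε) with hI
    have hmem : ∀ ψ : ℝ, ψ ∈ I ↔ ‖(ε * ψ : ℂ)‖ ≤ r / 2 := by
      intro ψ
      rw [hI, mem_Icc, ← abs_le, le_div_iff₀ hε]
      simp [abs_of_pos hε, mul_comm]
    have hint1 : IntegrableOn (fun ψ : ℝ => Complex.exp (-ψ ^ 2 * B (ε * ψ))) I := by
      refine ContinuousOn.integrableOn_compact isCompact_Icc ?_
      have : ContinuousOn (fun ψ : ℝ => B (ε * ψ)) I :=
        hB.continuousOn.comp (by fun_prop) fun ψ hψ => by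
          have := (hmem ψ).1 hψ
          rw [mem_closedBall_zero_iff]
          linarith
      exact (ContinuousOn.mul (by fun_prop : Continuous fun ψ : ℝ => -(ψ : ℂ) ^ 2).continuousOn
        this).cexp
    have hint2 : ∀ k, Integrable fun ψ : ℝ =>
        (ψ : ℂ) ^ k * gaussianTaylorCoeff B r k ψ * (ε : ℂ) ^ k := fun k =>
      (integrable_pow_mul_gaussianTaylorCoeff hr hb hB.continuousOn hre k).mul_const _
    simp_rw [← integral_mul_const]
    rw [← integral_finsetSum _ fun k _ => hint2 k, ← integral_indicator measurableSet_Icc,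
      ← integral_sub ((integrable_indicator_iff measurableSet_Icc).2 hint1)
        (integrable_finsetSum _ fun k _ => hint2 k)]
    rw [mul_right_comm, ← integral_const_mul]
    refine norm_integral_le_of_norm_le
      ((integrable_abs_pow_mul_exp_neg_mul_sq hb K).const_mul _) (.of_forall fun ψ => ?_)
    have hnorm : ‖(ε * ψ : ℂ)‖ = ε * |ψ| := by simp [abs_of_pos hε]
    have hsum : ∑ k ∈ Finset.range K, (ψ : ℂ) ^ k * gaussianTaylorCoeff B r k ψ * (ε : ℂ) ^ k
        = ∑ k ∈ Finset.range K, (ε * ψ : ℂ) ^ k * gaussianTaylorCoeff B r k ψ :=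
      Finset.sum_congr rfl fun k _ => by ring
    rw [hsum]
    have hgoal : (2 + K * 2 ^ K) / r ^ K * ε ^ K * (|ψ| ^ K * Real.exp (-b * ψ ^ 2))
        = (2 + K * 2 ^ K) * (‖(ε * ψ : ℂ)‖ / r) ^ K * Real.exp (-b * ψ ^ 2) := by
      rw [hnorm, div_pow, mul_pow]
      field_simp
    rw [hgoal]
    by_cases hψ : ψ ∈ I
    · rw [indicator_of_mem hψ]
      refine (norm_exp_sub_sum_gaussianTaylorCoeff_le hr hB hre K ψ ((hmem ψ).1 hψ)).trans ?_
      gcongr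
      have : (0 : ℝ) ≤ K * 2 ^ K := by positivity
      linarith
    · -- outside the interval `1 ≤ 2 ‖εψ‖ / r`, so lower powers are dominated by the `K`-th one
      rw [indicator_of_notMem hψ, zero_sub, norm_neg]
      set t := ‖(ε * ψ : ℂ)‖ / r with ht
      have ht1 : 1 ≤ 2 * t := by
        have : r / 2 < ‖(ε * ψ : ℂ)‖ := not_le.1 fun h => hψ ((hmem ψ).2 h)
        rw [ht, mul_div_assoc', le_div_iff₀ hr]
        linarith
      have ht0 : 0 ≤ t := by positivity
      calc _ ≤ ∑ k ∈ Finset.range K, (2 * t) ^ K * Real.exp (-b * ψ ^ 2) := by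
            refine (norm_sum_le _ _).trans (Finset.sum_le_sum fun k hk => ?_)
            rw [norm_mul, norm_pow]
            calc _ ≤ ‖(ε * ψ : ℂ)‖ ^ k * (Real.exp (-b * ψ ^ 2) / r ^ k) := by
                  gcongr
                  exact norm_gaussianTaylorCoeff_le hr hre k ψ
              _ = t ^ k * Real.exp (-b * ψ ^ 2) := by rw [ht, div_pow]; field_simp
              _ ≤ (2 * t) ^ k * Real.exp (-b * ψ ^ 2) := by gcongr; linarith
              _ ≤ _ := by
                  gcongr
                  exact (Finset.mem_range.1 hk).le
        _ = (K * 2 ^ K) * t ^ K * Real.exp (-b * ψ ^ 2) := by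
            rw [Finset.sum_const, Finset.card_range, nsmul_eq_mul, mul_pow]
            ring
        _ ≤ _ := by gcongr; linarith

end

/-! ### The saddle point of the Bromwich integral -/

/-- A holomorphic function with a double zero at `0` is `z ^ 2` times a holomorphic function. -/
lemma exists_eq_sq_mul {f f' : ℂ → ℂ} {U : Set ℂ} {d : ℂ} (hU : IsOpen U) (h0U : (0 : ℂ) ∈ U)
    (hf : ∀ z ∈ U, HasDerivAt f (f' z) z) (h0 : f 0 = 0) (h0' : f' 0 = 0)
    (hd : HasDerivAt f' d 0) :
    ∃ B : ℂ → ℂ, DifferentiableOn ℂ B U ∧ B 0 = d / 2 ∧ ∀ z ∈ U, f z = z ^ 2 * B z := by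
  have hUn := hU.mem_nhds h0U
  have hfd : DifferentiableOn ℂ f U := fun z hz =>
    (hf z hz).differentiableAt.differentiableWithinAt
  set B := dslope (dslope f 0) 0 with hBdef
  have hB : DifferentiableOn ℂ B U :=
    (Complex.differentiableOn_dslope hUn).2 ((Complex.differentiableOn_dslope hUn).2 hfd)
  have h1 : dslope f 0 0 = 0 := by rw [dslope_same, (hf 0 h0U).deriv, h0']
  have hfac : ∀ z, f z = z ^ 2 * B z := by
    intro z
    have e1 := sub_smul_dslope f 0 z
    have e2 := sub_smul_dslope (dslope f 0) 0 z
    simp only [sub_zero, smul_eq_mul, h0, h1] at e1 e2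
    rw [← e1, ← e2, hBdef]
    ring
  refine ⟨B, hB, ?_, fun z _ => hfac z⟩
  -- near `0`, `f' z = z * (2 * B z + z * B' z)`
  have hB' : DifferentiableOn ℂ (deriv B) U := hB.deriv hU
  have e : f' =ᶠ[𝓝 0] fun z => z * (2 * B z + z * deriv B z) := by
    filter_upwards [hUn] with z hz
    have hBz : HasDerivAt B (deriv B z) z := (hB.differentiableAt (hU.mem_nhds hz)).hasDerivAt
    have := ((hasDerivAt_pow 2 z).mul hBz).congr_of_eventuallyEq
      (.of_forall fun w => hfac w : f =ᶠ[𝓝 z] _)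
    rw [(hf z hz).unique this]
    simp
    ring
  have hu : HasDerivAt (fun z => 2 * B z + z * deriv B z)
      (deriv (fun z => 2 * B z + z * deriv B z) 0) 0 :=
    (((hB.differentiableAt hUn).const_mul 2).add
      (differentiableAt_id.mul (hB'.differentiableAt hUn))).hasDerivAt
  have h2 := ((hasDerivAt_id (0 : ℂ)).mul hu).congr_of_eventuallyEq e
  have := hd.unique h2
  simp at this
  rw [this]
  ring

/-- The phase of the Bromwich integral around its saddle point, normalised to vanish there. -/
noncomputable def saddlePhase (γ : ℝ) (η : ℂ) : ℂ :=
  γ * (1 + η * Complex.I) ^ (((γ - 1) / γ : ℝ) : ℂ) - (γ - 1) * (1 + η * Complex.I) - 1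

lemma one_add_mul_I_mem_slitPlane {η : ℂ} (hη : η ∈ Metric.ball (0 : ℂ) 1) :
    1 + η * Complex.I ∈ Complex.slitPlane := by
  left
  have := (Complex.abs_im_le_norm η).trans_lt (mem_ball_zero_iff.1 hη)
  simp only [Complex.add_re, Complex.one_re, Complex.mul_re, Complex.I_re, Complex.I_im]
  linarith [(abs_lt.1 this).2]

lemma hasDerivAt_one_add_mul_I_cpow (c : ℂ) {η : ℂ} (hη : η ∈ Metric.ball (0 : ℂ) 1) :
    HasDerivAt (fun η : ℂ => (1 + η * Complex.I) ^ c)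
      (c * (1 + η * Complex.I) ^ (c - 1) * Complex.I) η := by
  have h1 : HasDerivAt (fun η : ℂ => 1 + η * Complex.I) Complex.I η := by
    simpa using ((hasDerivAt_id η).mul_const Complex.I).const_add 1
  exact h1.cpow_const (one_add_mul_I_mem_slitPlane hη)

lemma exists_saddlePhase_eq {γ : ℝ} (hγ : 1 < γ) :
    ∃ B : ℂ → ℂ, DifferentiableOn ℂ B (Metric.ball 0 1) ∧
      B 0 = ((γ - 1) / (2 * γ) : ℝ) ∧
      ∀ η ∈ Metric.ball (0 : ℂ) 1, saddlePhase γ η = η ^ 2 * B η := by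
  have hγ0 : (γ : ℂ) ≠ 0 := by
    rw [Complex.ofReal_ne_zero]; linarith
  set a : ℂ := (((γ - 1) / γ : ℝ) : ℂ) with ha
  have haγ : (γ : ℂ) * a = γ - 1 := by
    rw [ha]; push_cast; field_simp
  have hder : ∀ η ∈ Metric.ball (0 : ℂ) 1, HasDerivAt (saddlePhase γ)
      (γ * (a * (1 + η * Complex.I) ^ (a - 1) * Complex.I) - (γ - 1) * Complex.I) η := by
    intro η hη
    have h1 : HasDerivAt (fun η : ℂ => (γ - 1 : ℂ) * (1 + η * Complex.I))
        ((γ - 1) * Complex.I) η := by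
      simpa using (((hasDerivAt_id η).mul_const Complex.I).const_add 1).const_mul (γ - 1 : ℂ)
    exact (((hasDerivAt_one_add_mul_I_cpow a hη).const_mul (γ : ℂ)).sub h1).sub_const 1
  have hder2 : HasDerivAt (fun η : ℂ =>
      γ * (a * (1 + η * Complex.I) ^ (a - 1) * Complex.I) - (γ - 1) * Complex.I)
      (γ * (a * ((a - 1) * Complex.I) * Complex.I)) 0 := by
    have h1 := hasDerivAt_one_add_mul_I_cpow (a - 1) (Metric.mem_ball_self (x := (0 : ℂ)) one_pos)
    simp only [zero_mul, add_zero, Complex.one_cpow, mul_one] at h1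
    exact (((h1.const_mul a).mul_const Complex.I).const_mul (γ : ℂ)).sub_const _
  have h0 : saddlePhase γ 0 = 0 := by simp [saddlePhase]
  obtain ⟨B, hB, hB0, hBe⟩ := exists_eq_sq_mul Metric.isOpen_ball
    (Metric.mem_ball_self one_pos) hder h0 (by
      simp only [zero_mul, add_zero, Complex.one_cpow, mul_one]
      linear_combination Complex.I * haγ) hder2
  refine ⟨B, hB, ?_, hBe⟩
  rw [hB0, show (γ : ℂ) * (a * ((a - 1) * Complex.I) * Complex.I)
    = (γ * a) * (a - 1) * Complex.I ^ 2 by ring, haγ, ha, Complex.I_sq]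
  push_cast
  field_simp
  ring

lemma saddlePhase_neg_re (γ η : ℝ) : (saddlePhase γ (-η : ℝ)).re = (saddlePhase γ η).re := by
  have h : (1 + ((-η : ℝ) : ℂ) * Complex.I) = (starRingEnd ℂ) (1 + (η : ℂ) * Complex.I) := by simp
  have h2 : (1 + (η : ℂ) * Complex.I).arg ≠ Real.pi := by
    have : 1 + (η : ℂ) * Complex.I ∈ Complex.slitPlane := by left; simp
    exact Complex.slitPlane_arg_ne_pi this
  unfold saddlePhase
  rw [h, Complex.conj_cpow _ _ h2, Complex.conj_ofReal]
  simp

lemma one_add_real_mul_I_mem_slitPlane (η : ℝ) : 1 + (η : ℂ) * Complex.I ∈ Complex.slitPlane := by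
  left; simp

/-- The real part of the phase increases away from the saddle point. -/
lemma strictMonoOn_saddlePhase_re {γ : ℝ} (hγ : 1 < γ) :
    StrictMonoOn (fun η : ℝ => (saddlePhase γ η).re) (Ici 0) := by
  have hγ0 : (γ : ℂ) ≠ 0 := by
    rw [Complex.ofReal_ne_zero]; linarith
  set a : ℂ := (((γ - 1) / γ : ℝ) : ℂ) with ha
  have haγ : (γ : ℂ) * a = γ - 1 := by
    rw [ha]; push_cast; field_simp
  have hd : ∀ η : ℝ, HasDerivAt (fun η : ℝ => (saddlePhase γ η).re)
      ((γ - 1) * (-((1 + (η : ℂ) * Complex.I) ^ (((-1 / γ : ℝ)) : ℂ)).im)) η := by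
    intro η
    have h0 : HasDerivAt (fun η : ℂ => 1 + η * Complex.I) Complex.I (η : ℂ) := by
      simpa using ((hasDerivAt_id (η : ℂ)).mul_const Complex.I).const_add 1
    have h1 := h0.cpow_const (c := a) (one_add_real_mul_I_mem_slitPlane η)
    have h2 : HasDerivAt (fun η : ℂ => (γ - 1 : ℂ) * (1 + η * Complex.I))
        ((γ - 1) * Complex.I) (η : ℂ) := h0.const_mul _
    have h3 : HasDerivAt (saddlePhase γ) _ (η : ℂ) := ((h1.const_mul (γ : ℂ)).sub h2).sub_const 1
    have h4 := h3.real_of_complex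
    convert h4 using 1
    have e : a - 1 = ((-1 / γ : ℝ) : ℂ) := by
      rw [ha]; push_cast; field_simp; ring
    rw [e, ← mul_assoc, ← mul_assoc, haγ]
    have e2 : ((γ : ℂ) - 1) = ((γ - 1 : ℝ) : ℂ) := by push_cast; ring
    rw [e2]
    simp only [Complex.sub_re, mul_assoc, Complex.re_ofReal_mul]
    simp
  -- for `η > 0` the argument of `1 + iη` lies in `(0, π)`, and so does its quotient by `γ`
  refine strictMonoOn_of_deriv_pos (convex_Ici 0)
    (fun η _ => (hd η).continuousAt.continuousWithinAt) fun η hη => ?_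
  rw [interior_Ici] at hη
  have hη : 0 < η := hη
  rw [(hd η).deriv, Complex.cpow_ofReal_im]
  have hz : (1 + (η : ℂ) * Complex.I) ≠ 0 :=
    Complex.slitPlane_ne_zero (one_add_real_mul_I_mem_slitPlane η)
  have harg : 0 < (1 + (η : ℂ) * Complex.I).arg := by
    refine lt_of_le_of_ne (Complex.arg_nonneg_iff.2 (by simpa using hη.le)) fun h => ?_
    have := (Complex.arg_eq_zero_iff.1 h.symm).2
    simp at this
    linarith
  have harg2 : (1 + (η : ℂ) * Complex.I).arg ≤ Real.pi := Complex.arg_le_pi _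
  have hsin : Real.sin ((1 + (η : ℂ) * Complex.I).arg * (-1 / γ)) < 0 := by
    have : (1 + (η : ℂ) * Complex.I).arg * (-1 / γ) = -((1 + (η : ℂ) * Complex.I).arg / γ) := by
      ring
    rw [this, Real.sin_neg, neg_lt_zero]
    refine Real.sin_pos_of_pos_of_lt_pi (by positivity) ?_
    rw [div_lt_iff₀ (by linarith)]
    nlinarith [Real.pi_pos]
  have hp : 0 < ‖1 + (η : ℂ) * Complex.I‖ ^ (-1 / γ) :=
    Real.rpow_pos_of_pos (norm_pos_iff.2 hz) _
  have := mul_neg_of_pos_of_neg hp hsin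
  have h1 : 0 < γ - 1 := by linarith
  exact mul_pos h1 (by linarith)

lemma saddlePhase_re_pos {γ : ℝ} (hγ : 1 < γ) {δ : ℝ} (hδ : 0 < δ) :
    0 < (saddlePhase γ δ).re := by
  have := strictMonoOn_saddlePhase_re hγ (mem_Ici.2 le_rfl) (mem_Ici.2 hδ.le) hδ
  simpa [saddlePhase] using this

lemma saddlePhase_re_le {γ : ℝ} (hγ : 1 < γ) {δ η : ℝ} (hδ : 0 < δ) (h : δ ≤ |η|) :
    (saddlePhase γ δ).re ≤ (saddlePhase γ η).re := by
  have h1 := (strictMonoOn_saddlePhase_re hγ).monotoneOn (mem_Ici.2 hδ.le)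
    (mem_Ici.2 (abs_nonneg η)) h
  refine h1.trans (le_of_eq ?_)
  rcases le_total 0 η with h' | h'
  · rw [abs_of_nonneg h']
  · rw [abs_of_nonpos h', saddlePhase_neg_re]

lemma exp_neg_saddlePhase (γ : ℝ) (η : ℂ) :
    Complex.exp (-saddlePhase γ η) = Complex.exp ((γ - 1) * (1 + η * Complex.I) + 1) *
      stableSymbol γ ((γ - 1) / γ) (1 + η * Complex.I) := by
  rw [stableSymbol, ← Complex.exp_add, saddlePhase]
  ring_nf

lemma continuous_saddlePhase (γ : ℝ) : Continuous fun η : ℝ => saddlePhase γ η := by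
  unfold saddlePhase
  have : Continuous fun η : ℝ => (1 + (η : ℂ) * Complex.I) ^ (((γ - 1) / γ : ℝ) : ℂ) :=
    Continuous.cpow (by fun_prop) continuous_const fun η => one_add_real_mul_I_mem_slitPlane η
  fun_prop

lemma integrable_exp_neg_saddlePhase_re {γ : ℝ} (hγ : 1 < γ) :
    Integrable fun η : ℝ => Real.exp (-(saddlePhase γ η).re) := by
  have h0 : 0 < (γ - 1) / γ := div_pos (by linarith) (by linarith)
  have h1 : (γ - 1) / γ < 1 := by rw [div_lt_one (by linarith)]; linarith
  have := ((integrable_stableSymbol_line (γ := γ) (by linarith) h0 h1 one_pos).norm.const_mul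
    (Real.exp γ))
  refine this.congr (.of_forall fun η => ?_)
  simp only
  have e := congrArg norm (exp_neg_saddlePhase γ η)
  rw [Complex.norm_exp, norm_mul, Complex.norm_exp] at e
  simp only [Complex.neg_re] at e
  rw [e]
  simp

/-- Splitting a sum over `range (2 * N)` whose odd terms vanish. -/
lemma sum_range_two_mul_of_odd_eq_zero {f : ℕ → ℂ} (h : ∀ k, Odd k → f k = 0) (N : ℕ) :
    ∑ k ∈ Finset.range (2 * N), f k = ∑ n ∈ Finset.range N, f (2 * n) := by
  induction N with
  | zero => simp
  | succ N ih =>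
    rw [Nat.mul_succ, Finset.sum_range_succ, Finset.sum_range_succ, ih, Finset.sum_range_succ,
      h (2 * N + 1) ⟨N, rfl⟩, add_zero]

/-- The contribution away from the saddle point is exponentially small. -/
lemma norm_integral_tail_le {γ : ℝ} (hγ : 1 < γ) {δ u : ℝ} (hδ : 0 < δ) (hu : 1 ≤ u) :
    ‖∫ η in (Icc (-δ) δ)ᶜ, Complex.exp (-u * saddlePhase γ (η : ℝ))‖
      ≤ Real.exp (-(u - 1) * (saddlePhase γ δ).re) *
        ∫ η : ℝ, Real.exp (-(saddlePhase γ η).re) := by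
  have hi := integrable_exp_neg_saddlePhase_re hγ
  calc _ ≤ ∫ η in (Icc (-δ) δ)ᶜ, Real.exp (-(u - 1) * (saddlePhase γ δ).re) *
        Real.exp (-(saddlePhase γ (η : ℝ)).re) := by
        refine norm_integral_le_of_norm_le (hi.const_mul _).integrableOn ?_
        filter_upwards [ae_restrict_mem measurableSet_Icc.compl] with η hη
        have hη' : δ ≤ |η| := by
          by_contra! h
          exact hη (abs_le.1 h.le)
        have h1 := saddlePhase_re_le hγ hδ hη'
        rw [Complex.norm_exp, ← Real.exp_add, Real.exp_le_exp, ← Complex.ofReal_neg,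
          Complex.re_ofReal_mul]
        nlinarith
    _ ≤ _ := by
        rw [integral_const_mul]
        exact mul_le_mul_of_nonneg_left
          (setIntegral_le_integral hi (.of_forall fun η => (Real.exp_pos _).le)) (Real.exp_pos _).le

lemma integrable_exp_neg_mul_saddlePhase {γ : ℝ} (hγ : 1 < γ) {u : ℝ} (hu : 1 ≤ u) :
    Integrable fun η : ℝ => Complex.exp (-u * saddlePhase γ η) := by
  refine (integrable_exp_neg_saddlePhase_re hγ).mono' ?_ (.of_forall fun η => ?_)
  · have := continuous_saddlePhase γ
    exact (by fun_prop : Continuous _).aestronglyMeasurable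
  · rw [Complex.norm_exp, Real.exp_le_exp, ← Complex.ofReal_neg, Complex.re_ofReal_mul]
    have h0 : 0 ≤ (saddlePhase γ η).re := by
      rcases eq_or_ne η 0 with rfl | h
      · simp [saddlePhase]
      · exact (saddlePhase_re_pos hγ (abs_pos.2 h)).le.trans
          (saddlePhase_re_le hγ (abs_pos.2 h) le_rfl)
    nlinarith

lemma exists_saddle_expansion {γ : ℝ} (hγ : 1 < γ) :
    ∃ c : ℕ → ℂ, c 0 = (Real.sqrt (2 * Real.pi * γ / (γ - 1)) : ℝ) ∧
      ∀ N : ℕ, ∃ M : ℝ, ∀ᶠ u : ℝ in atTop,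
      ‖(Real.sqrt u : ℂ) * (∫ η : ℝ, Complex.exp (-u * saddlePhase γ η))
        - ∑ n ∈ Finset.range N, c n * ((u ^ n)⁻¹ : ℝ)‖ ≤ M * (u ^ N)⁻¹ := by
  obtain ⟨B, hB, hB0, hBe⟩ := exists_saddlePhase_eq hγ
  set b : ℝ := (γ - 1) / (2 * γ) with hb
  have hbpos : 0 < b := div_pos (by linarith) (by linarith)
  -- a closed disc on which `Re B` stays above half of its value at the centre
  obtain ⟨r, hr, hr1, hre⟩ : ∃ r : ℝ, 0 < r ∧ r < 1 ∧
      ∀ z ∈ Metric.closedBall (0 : ℂ) r, b / 2 ≤ (B z).re := by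
    have hc : ContinuousAt (fun z => (B z).re) 0 :=
      Complex.continuous_re.continuousAt.comp
        (hB.continuousOn.continuousAt (Metric.ball_mem_nhds _ one_pos))
    have h1 : ∀ᶠ z in 𝓝 (0 : ℂ), b / 2 < (B z).re := by
      refine hc.eventually_const_lt ?_
      simp only [hB0, Complex.ofReal_re]
      linarith
    obtain ⟨ρ, hρ, h⟩ := Metric.eventually_nhds_iff_ball.1 h1
    refine ⟨min (ρ / 2) (1 / 2), by positivity, ?_, fun z hz => (h z ?_).le⟩
    · exact (min_le_right _ _).trans_lt (by norm_num)
    · rw [mem_closedBall_zero_iff] at hz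
      rw [mem_ball_zero_iff]
      linarith [hz.trans (min_le_left _ _)]
  have hsub : Metric.closedBall (0 : ℂ) r ⊆ Metric.ball 0 1 := Metric.closedBall_subset_ball hr1
  obtain ⟨c, hc0, hodd, hexp⟩ := exists_laplace_expansion hr (half_pos hbpos) (hB.mono hsub) hre
  refine ⟨fun n => c (2 * n), ?_, fun N => ?_⟩
  · simp only [mul_zero]
    rw [hc0, hB0]
    have : ∀ ψ : ℝ, Complex.exp (-(ψ : ℂ) ^ 2 * (b : ℝ)) = (Real.exp (-b * ψ ^ 2) : ℝ) := by
      intro ψ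
      push_cast
      ring_nf
    simp_rw [this]
    rw [integral_complex_ofReal, integral_gaussian]
    congr 2
    rw [hb]
    have : γ - 1 ≠ 0 := by linarith
    field_simp
  · obtain ⟨M, hM⟩ := hexp (2 * N)
    set δ := r / 2 with hδ
    have hδ0 : 0 < δ := half_pos hr
    set m := (saddlePhase γ δ).re with hm
    have hmpos : 0 < m := saddlePhase_re_pos hγ hδ0
    set C := ∫ η : ℝ, Real.exp (-(saddlePhase γ η).re) with hC
    have hC0 : 0 ≤ C := integral_nonneg fun η => (Real.exp_pos _).le
    have htail : ∀ᶠ u : ℝ in atTop,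
        Real.sqrt u * (Real.exp (-(u - 1) * m) * C) ≤ 1 * (u ^ N)⁻¹ := by
      have h1 : Tendsto (fun u : ℝ => u ^ (N + 1 : ℕ) * Real.exp (-m * u)) atTop (𝓝 0) := by
        have := tendsto_rpow_mul_exp_neg_mul_atTop_nhds_zero (N + 1 : ℕ) m hmpos
        simpa only [Real.rpow_natCast] using this
      have h2 := h1.mul_const (Real.exp m * C)
      rw [zero_mul] at h2
      filter_upwards [h2.eventually_lt_const one_pos, eventually_ge_atTop 1] with u hu hu1
      rw [one_mul, ← one_div, le_div_iff₀ (by positivity)]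
      have hs : Real.sqrt u ≤ u := by
        rw [Real.sqrt_le_left (by linarith)]
        nlinarith
      calc Real.sqrt u * (Real.exp (-(u - 1) * m) * C) * u ^ N
          ≤ u * (Real.exp (-(u - 1) * m) * C) * u ^ N := by gcongr
        _ = u ^ (N + 1) * Real.exp (-m * u) * (Real.exp m * C) := by
            rw [show -(u - 1) * m = -m * u + m by ring, Real.exp_add]
            ring
        _ ≤ 1 := hu.le
    refine ⟨M + 1, ?_⟩
    filter_upwards [htail, eventually_ge_atTop 1] with u hu hu1
    have hu0 : 0 < u := by linarith
    set ε : ℝ := (Real.sqrt u)⁻¹ with hε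
    have hsq : 0 < Real.sqrt u := Real.sqrt_pos.2 hu0
    have hε0 : 0 < ε := inv_pos.2 hsq
    have hε2 : ∀ n : ℕ, ε ^ (2 * n) = (u ^ n)⁻¹ := by
      intro n
      rw [hε, inv_pow, pow_mul, Real.sq_sqrt hu0.le]
    have hmain := hM ε hε0
    rw [sum_range_two_mul_of_odd_eq_zero (fun k hk => by rw [hodd k hk, zero_mul]), hε2] at hmain
    have hsum : ∑ n ∈ Finset.range N, c (2 * n) * (ε : ℂ) ^ (2 * n)
        = ∑ n ∈ Finset.range N, c (2 * n) * ((u ^ n)⁻¹ : ℝ) := by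
      refine Finset.sum_congr rfl fun n _ => ?_
      rw [← hε2]
      push_cast
      rfl
    rw [hsum] at hmain
    -- the substitution `η = ε ψ` near the saddle point
    have hsubst : (Real.sqrt u : ℂ) * ∫ η in Icc (-δ) δ, Complex.exp (-u * saddlePhase γ (η : ℝ))
        = ∫ ψ in Icc (-(δ / ε)) (δ / ε), Complex.exp (-ψ ^ 2 * B (ε * ψ)) := by
      have hdε : 0 ≤ δ / ε := by positivity
      rw [integral_Icc_eq_integral_Ioc, integral_Icc_eq_integral_Ioc,
        ← intervalIntegral.integral_of_le (by linarith),
        ← intervalIntegral.integral_of_le (by linarith)]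
      have := intervalIntegral.integral_comp_mul_left
        (a := -(δ / ε)) (b := δ / ε)
        (fun η : ℝ => Complex.exp (-u * saddlePhase γ (η : ℝ))) hε0.ne'
      rw [mul_neg, mul_div_cancel₀ _ hε0.ne'] at this
      rw [show (Real.sqrt u : ℂ) = ((ε⁻¹ : ℝ) : ℂ) by rw [hε, inv_inv], ← Complex.real_smul, ← this]
      refine intervalIntegral.integral_congr fun ψ hψ => ?_
      rw [uIcc_of_le (by linarith), mem_Icc, ← abs_le, le_div_iff₀ hε0] at hψ
      have hmem : ((ε * ψ : ℝ) : ℂ) ∈ Metric.ball (0 : ℂ) 1 := by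
        rw [mem_ball_zero_iff, Complex.norm_real, Real.norm_eq_abs, abs_mul, abs_of_pos hε0,
          mul_comm]
        linarith
      rw [hBe _ hmem]
      have e : (u : ℂ) * (ε : ℂ) ^ 2 = 1 := by
        have := hε2 1
        rw [mul_one, pow_one] at this
        rw [← Complex.ofReal_pow, this, ← Complex.ofReal_mul, mul_inv_cancel₀ hu0.ne',
          Complex.ofReal_one]
      congr 1
      push_cast
      linear_combination (-(ψ : ℂ) ^ 2 * B (ε * ψ)) * e
    rw [← integral_add_compl measurableSet_Icc (integrable_exp_neg_mul_saddlePhase hγ hu1)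
      (s := Icc (-δ) δ), mul_add, hsubst, add_sub_right_comm]
    refine (norm_add_le _ _).trans ?_
    rw [add_mul]
    refine add_le_add hmain (le_trans ?_ hu)
    rw [norm_mul, Complex.norm_real, Real.norm_of_nonneg hsq.le]
    gcongr
    exact norm_integral_tail_le hγ hδ0 hu1

/-! ### The small-time expansion of the stable density -/

lemma ofReal_mul_cpow_ofReal {c : ℝ} (hc : 0 < c) {z : ℂ} (hz : z ≠ 0) (a : ℝ) :
    ((c : ℂ) * z) ^ (a : ℂ) = (c ^ a : ℝ) * z ^ (a : ℂ) := by
  have hc' : (c : ℂ) ≠ 0 := Complex.ofReal_ne_zero.2 hc.ne'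
  rw [Complex.cpow_def_of_ne_zero (mul_ne_zero hc' hz), Complex.cpow_def_of_ne_zero hz,
    Complex.log_ofReal_mul hc hz, add_mul, Complex.exp_add, Real.rpow_def_of_pos hc]
  push_cast
  rfl

/-- The stable density, as the real part of a Bromwich integral. -/
noncomputable def stableDensity (γ x : ℝ) : ℝ := (bromwich γ ((γ - 1) / γ) 1 x).re

/-- The Bromwich integral over the line through the saddle point. -/
lemma bromwich_eq_saddle {γ : ℝ} (hγ : 1 < γ) {x : ℝ} (hx : 0 < x) :
    bromwich γ ((γ - 1) / γ) 1 ((γ - 1) * x)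
      = ((x ^ (-γ) / (2 * Real.pi) * Real.exp (-(x ^ (-(γ - 1)))) : ℝ) : ℂ) *
        ∫ η : ℝ, Complex.exp (-(x ^ (-(γ - 1)) : ℝ) * saddlePhase γ η) := by
  have h0 : 0 < (γ - 1) / γ := div_pos (by linarith) (by linarith)
  have h1 : (γ - 1) / γ < 1 := by rw [div_lt_one (by linarith)]; linarith
  set c : ℝ := x ^ (-γ) with hc
  set u : ℝ := x ^ (-(γ - 1)) with hu
  have hc0 : 0 < c := Real.rpow_pos_of_pos hx _
  have hca : c ^ ((γ - 1) / γ) = u := by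
    rw [hc, hu, ← Real.rpow_mul hx.le]
    congr 1
    field_simp
  have hcx : c * x = u := by
    rw [hc, hu, show -(γ - 1) = -γ + 1 by ring, Real.rpow_add hx, Real.rpow_one]
  have hcx' : (c : ℂ) * x = u := by rw [← Complex.ofReal_mul, hcx]
  rw [bromwich_eq (by linarith) h0 h1 one_pos hc0, bromwich]
  have hsub := Measure.integral_comp_mul_left (fun y : ℝ =>
    Complex.exp ((c + y * Complex.I) * ((γ - 1) * x : ℝ)) *
      stableSymbol γ ((γ - 1) / γ) (c + y * Complex.I)) c
  rw [abs_of_pos (inv_pos.2 hc0)] at hsub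
  have hpt : ∀ η : ℝ, Complex.exp ((c + (c * η : ℝ) * Complex.I) * ((γ - 1) * x : ℝ)) *
      stableSymbol γ ((γ - 1) / γ) (c + (c * η : ℝ) * Complex.I)
      = (Real.exp (-u) : ℝ) * Complex.exp (-(u : ℝ) * saddlePhase γ η) := by
    intro η
    have e : (c + (c * η : ℝ) * Complex.I : ℂ) = c * (1 + η * Complex.I) := by
      push_cast; ring
    rw [e, stableSymbol, ofReal_mul_cpow_ofReal hc0
      (Complex.slitPlane_ne_zero (one_add_real_mul_I_mem_slitPlane η)), hca, ← Complex.exp_add,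
      Complex.ofReal_exp, ← Complex.exp_add, saddlePhase]
    congr 1
    push_cast
    linear_combination ((γ : ℂ) - 1) * (1 + η * Complex.I) * hcx'
  simp_rw [hpt] at hsub
  rw [integral_const_mul, eq_inv_smul_iff₀ hc0.ne'] at hsub
  rw [← hsub, Complex.real_smul, Complex.real_smul]
  push_cast
  ring

lemma bigO_of_eventually_le {κ : ℝ} (hκ : 0 < κ) {f : ℝ → ℝ} {N : ℕ} {M : ℝ}
    (h : ∀ᶠ u : ℝ in atTop, ∀ x : ℝ, 0 < x → x ^ (-κ) = u → |f x| ≤ M * (u ^ N)⁻¹) :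
    f =O[𝓝[>] 0] fun x : ℝ => x ^ ((N : ℝ) * κ) := by
  refine IsBigO.of_bound M ?_
  have ht : Tendsto (fun x : ℝ => x ^ (-κ)) (𝓝[>] 0) atTop :=
    tendsto_rpow_neg_nhdsGT_zero (by linarith)
  filter_upwards [ht.eventually h, self_mem_nhdsWithin] with x hx hx0
  have hx0 : 0 < x := hx0
  have h1 := hx x hx0 rfl
  rw [Real.norm_eq_abs, Real.norm_of_nonneg (Real.rpow_nonneg hx0.le _)]
  convert h1 using 2
  rw [← Real.rpow_natCast, ← Real.rpow_mul hx0.le, ← Real.rpow_neg hx0.le]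
  ring_nf

lemma one_add_sum_Ico_eq {c : ℕ → ℝ} (hc : c 0 = 1) (κ x : ℝ) {N : ℕ} (hN : 1 ≤ N) :
    1 + ∑ n ∈ Finset.Ico 1 N, c n * x ^ ((n : ℝ) * κ)
      = ∑ n ∈ Finset.range N, c n * x ^ ((n : ℝ) * κ) := by
  rw [Finset.range_eq_Ico, Finset.sum_eq_sum_Ico_succ_bot hN, hc]
  simp

/-- Existence of Zolotarev's coefficients. -/
lemma exists_isZolotarevCoeff_stableDensity {γ : ℝ} (hγ : 1 < γ) :
    ∃ S : ℕ → ℝ, IsZolotarevCoeff γ (stableDensity γ) S := by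
  obtain ⟨c, hc0, hc⟩ := exists_saddle_expansion hγ
  set A : ℝ := Real.sqrt (2 * Real.pi * (1 - 1 / γ)) / (2 * Real.pi) with hA
  have hS0 : A * (c 0).re = 1 := by
    rw [hc0, Complex.ofReal_re, hA, div_mul_eq_mul_div, ← Real.sqrt_mul, div_eq_one_iff_eq]
    · rw [Real.sqrt_eq_iff_mul_self_eq (by
        have : 0 ≤ 1 - 1 / γ := by
          rw [sub_nonneg, div_le_one (by linarith)]; exact hγ.le
        have : 0 < γ - 1 := by linarith
        positivity) (by positivity)]
      have : γ - 1 ≠ 0 := by linarith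
      field_simp
    · positivity
    · have : 0 ≤ 1 - 1 / γ := by
        rw [sub_nonneg, div_le_one (by linarith)]; exact hγ.le
      positivity
  refine ⟨fun n => A * (c n).re, hS0, fun N hN => ?_⟩
  obtain ⟨M, hM⟩ := hc N
  have hAnn : 0 ≤ A := by positivity
  refine bigO_of_eventually_le (κ := γ - 1) (M := A * M) (by linarith) ?_
  filter_upwards [hM] with u hu x hx hxu
  rw [one_add_sum_Ico_eq (c := fun n => A * (c n).re) hS0 _ _ hN]
  have hpow : ∀ n : ℕ, x ^ ((n : ℝ) * (γ - 1)) = (u ^ n)⁻¹ := by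
    intro n
    rw [← hxu, ← Real.rpow_natCast, ← Real.rpow_mul hx.le, ← Real.rpow_neg hx.le]
    ring_nf
  have hinv : 1 / x ^ (γ - 1) = u := by rw [← hxu, Real.rpow_neg hx.le, one_div]
  have hsq : x ^ ((γ + 1) / 2) * x ^ (-γ) = Real.sqrt u := by
    rw [← Real.rpow_add hx, Real.sqrt_eq_rpow, ← hxu, ← Real.rpow_mul hx.le]
    ring_nf
  have hre : Real.sqrt (2 * Real.pi * (1 - 1 / γ)) * x ^ ((γ + 1) / 2) * Real.exp (1 / x ^ (γ - 1))
      * stableDensity γ ((γ - 1) * x) - ∑ n ∈ Finset.range N, A * (c n).re * x ^ ((n : ℝ) * (γ - 1))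
      = A * ((Real.sqrt u : ℂ) * (∫ η : ℝ, Complex.exp (-u * saddlePhase γ η))
        - ∑ n ∈ Finset.range N, c n * ((u ^ n)⁻¹ : ℝ)).re := by
    rw [stableDensity, bromwich_eq_saddle hγ hx, Complex.re_ofReal_mul, Complex.sub_re,
      Complex.re_ofReal_mul, Complex.re_sum, hinv, hxu, mul_sub A, Finset.mul_sum, ← hsq]
    congr 1
    · have : Real.exp u * Real.exp (-u) = 1 := by rw [← Real.exp_add]; simp
      rw [hA]
      linear_combination (Real.sqrt (2 * Real.pi * (1 - 1 / γ)) * x ^ ((γ + 1) / 2) * x ^ (-γ)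
        / (2 * Real.pi) * (∫ η : ℝ, Complex.exp (-u * saddlePhase γ η)).re) * this
    · refine Finset.sum_congr rfl fun n _ => ?_
      rw [Complex.re_mul_ofReal, hpow, mul_assoc]
  rw [hre, abs_mul, abs_of_nonneg hAnn, mul_assoc]
  gcongr
  exact (Complex.abs_re_le_norm _).trans hu

/-! ### Consequences of an expansion at the origin -/

/-- `exp (-x ^ (-κ))` vanishes at `0+` faster than any power of `x`. -/
lemma tendsto_rpow_mul_exp_neg_one_div {κ : ℝ} (hκ : 0 < κ) (q : ℝ) :
    Tendsto (fun x : ℝ => x ^ q * Real.exp (-(1 / x ^ κ))) (𝓝[>] 0) (𝓝 0) := by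
  have ht : Tendsto (fun x : ℝ => x ^ (-κ)) (𝓝[>] 0) atTop :=
    tendsto_rpow_neg_nhdsGT_zero (by linarith)
  have := (tendsto_rpow_mul_exp_neg_mul_atTop_nhds_zero (-q / κ) 1 one_pos).comp ht
  refine this.congr' ?_
  filter_upwards [self_mem_nhdsWithin] with x hx
  have hx : 0 < x := hx
  simp only [Function.comp]
  rw [← Real.rpow_mul hx.le, show -κ * (-q / κ) = q by field_simp, Real.rpow_neg hx.le, one_div]
  ring_nf

lemma sqrt_two_pi_mul_pos {γ : ℝ} (hγ : 1 < γ) :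
    0 < Real.sqrt (2 * Real.pi * (1 - 1 / γ)) := by
  have : 0 < 1 - 1 / γ := by
    rw [sub_pos, div_lt_one (by linarith)]; exact hγ
  positivity

lemma HasStableExpansion.tendsto_one {γ p : ℝ} (hγ : 1 < γ) {f : ℝ → ℝ} {c : ℕ → ℝ}
    (h : HasStableExpansion γ p f c) :
    Tendsto (fun x : ℝ => Real.sqrt (2 * Real.pi * (1 - 1 / γ)) * x ^ p *
      Real.exp (1 / x ^ (γ - 1)) * f ((γ - 1) * x)) (𝓝[>] 0) (𝓝 1) := by
  have h1 := h 1 le_rfl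
  have h2 : Tendsto (fun x : ℝ => x ^ (((1 : ℕ) : ℝ) * (γ - 1))) (𝓝[>] 0) (𝓝 0) := by
    have hp : (0 : ℝ) < ((1 : ℕ) : ℝ) * (γ - 1) := by simp; linarith
    have := (Real.continuousAt_rpow_const 0 _ (Or.inr hp.le)).tendsto
    rw [Real.zero_rpow hp.ne'] at this
    exact this.mono_left nhdsWithin_le_nhds
  have h3 := (h1.trans_tendsto h2).add_const 1
  simpa using h3

/-- Positivity near `0` of a function with a stable expansion. -/
lemma HasStableExpansion.eventually_pos {γ p : ℝ} (hγ : 1 < γ) {f : ℝ → ℝ} {c : ℕ → ℝ}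
    (h : HasStableExpansion γ p f c) : ∀ᶠ x in 𝓝[>] 0, 0 < f ((γ - 1) * x) := by
  filter_upwards [(h.tendsto_one hγ).eventually_const_lt one_pos, self_mem_nhdsWithin]
    with x hx hx0
  have hx0 : 0 < x := hx0
  have : 0 < Real.sqrt (2 * Real.pi * (1 - 1 / γ)) * x ^ p * Real.exp (1 / x ^ (γ - 1)) := by
    have := sqrt_two_pi_mul_pos hγ
    positivity
  exact pos_of_mul_pos_right hx this.le

lemma tendsto_mul_nhdsGT_zero {k : ℝ} (hk : 0 < k) :
    Tendsto (fun x : ℝ => k * x) (𝓝[>] 0) (𝓝[>] 0) := by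
  refine tendsto_nhdsWithin_of_tendsto_nhds_of_eventually_within _ ?_ ?_
  · exact ((continuous_const_mul k).tendsto' 0 0 (by simp)).mono_left nhdsWithin_le_nhds
  · filter_upwards [self_mem_nhdsWithin] with x hx
    exact mul_pos hk hx

lemma eventually_nhdsGT_of_mul {k : ℝ} (hk : 0 < k) {P : ℝ → Prop}
    (h : ∀ᶠ x in 𝓝[>] 0, P (k * x)) : ∀ᶠ x in 𝓝[>] 0, P x := by
  have := (tendsto_mul_nhdsGT_zero (inv_pos.2 hk)).eventually h
  simpa [mul_inv_cancel_left₀ hk.ne'] using this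

/-- A function with a stable expansion is flat at `0+`. -/
lemma HasStableExpansion.eventually_abs_le {γ p : ℝ} (hγ : 1 < γ) {f : ℝ → ℝ} {c : ℕ → ℝ}
    (h : HasStableExpansion γ p f c) : ∀ᶠ x in 𝓝[>] 0, |f x| ≤ x ^ 2 := by
  refine eventually_nhdsGT_of_mul (k := γ - 1) (by linarith) ?_
  set A := Real.sqrt (2 * Real.pi * (1 - 1 / γ)) with hA
  have hA0 : 0 < A := sqrt_two_pi_mul_pos hγ
  have hk : 0 < (γ - 1) ^ 2 * A / 2 := by
    have : 0 < γ - 1 := by linarith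
    positivity
  filter_upwards [(h.tendsto_one hγ).abs.eventually_lt_const (show |(1 : ℝ)| < 2 by norm_num),
    (tendsto_rpow_mul_exp_neg_one_div (κ := γ - 1) (by linarith) (-p - 2)).eventually_lt_const hk,
    self_mem_nhdsWithin] with x hx hx1 hx0
  have hx0 : 0 < x := hx0
  rw [abs_mul, abs_of_pos (by positivity)] at hx
  have e1 : x ^ (-p - 2) * x ^ p * x ^ 2 = 1 := by
    rw [← Real.rpow_natCast, ← Real.rpow_add hx0, ← Real.rpow_add hx0]
    convert Real.rpow_zero x using 2
    push_cast
    ring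
  have e2 : Real.exp (-(1 / x ^ (γ - 1))) * Real.exp (1 / x ^ (γ - 1)) = 1 := by
    rw [← Real.exp_add]; simp
  calc |f ((γ - 1) * x)| = (A * x ^ p * Real.exp (1 / x ^ (γ - 1)) * |f ((γ - 1) * x)|) *
        (x ^ (-p - 2) * Real.exp (-(1 / x ^ (γ - 1)))) * (x ^ 2 / A) := by
        field_simp
        linear_combination (-|f ((γ - 1) * x)|) * e1
          - (|f ((γ - 1) * x)| * (x ^ (-p - 2) * x ^ p * x ^ 2)) * e2
    _ ≤ 2 * ((γ - 1) ^ 2 * A / 2) * (x ^ 2 / A) := by gcongr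
    _ = ((γ - 1) * x) ^ 2 := by field_simp

/-! ### Positivity and existence of the stable density -/

section

variable {γ : ℝ}

lemma stableExponent_pos (hγ : 1 < γ) : 0 < (γ - 1) / γ := div_pos (by linarith) (by linarith)

lemma stableExponent_lt_one (hγ : 1 < γ) : (γ - 1) / γ < 1 := by
  rw [div_lt_one (by linarith)]; linarith

lemma continuous_stableDensity (hγ : 1 < γ) : Continuous (stableDensity γ) :=
  Complex.continuous_re.comp
    (continuous_bromwich (by linarith) (stableExponent_pos hγ) (stableExponent_lt_one hγ) one_pos)

lemma exists_abs_stableDensity_le (hγ : 1 < γ) : ∃ K : ℝ, ∀ x, |stableDensity γ x| ≤ K := by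
  obtain ⟨K, hK⟩ := exists_norm_bromwich_le_const (γ := γ) (by linarith) (stableExponent_pos hγ)
    (stableExponent_lt_one hγ)
  exact ⟨K, fun x => (Complex.abs_re_le_norm _).trans (hK 1 x one_pos)⟩

lemma stableSymbol_ofReal {l : ℝ} (hl : 0 ≤ l) (α : ℝ) :
    stableSymbol γ α l = (Real.exp (-γ * l ^ α) : ℝ) := by
  rw [stableSymbol, ← Complex.ofReal_cpow hl]
  push_cast
  rfl

lemma integrableOn_exp_mul_stableDensity (hγ : 1 < γ) {l : ℝ} (hl : 0 < l) :
    IntegrableOn (fun x => Real.exp (-l * x) * stableDensity γ x) (Ioi 0) := by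
  obtain ⟨K, hK⟩ := exists_abs_stableDensity_le hγ
  exact (integrableOn_exp_mul_Ioi (a := -l) (by linarith) 0).mul_bdd (c := K)
    (continuous_stableDensity hγ).aestronglyMeasurable (.of_forall hK)

lemma laplace_stableDensity (hγ : 1 < γ) {l : ℝ} (hl : 0 < l) :
    ∫ x in Ioi (0 : ℝ), Real.exp (-l * x) * stableDensity γ x
      = Real.exp (-γ * l ^ ((γ - 1) / γ)) := by
  have h := laplace_bromwich (γ := γ) (by linarith) (stableExponent_pos hγ)
    (stableExponent_lt_one hγ) one_pos hl
  have hi := integrableOn_exp_mul_bromwich (γ := γ) (by linarith) (stableExponent_pos hγ)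
    (stableExponent_lt_one hγ) one_pos hl
  have h2 := congrArg Complex.re h
  rw [stableSymbol_ofReal hl.le, Complex.ofReal_re] at h2
  rw [← h2]
  have h3 := integral_re hi
  simp only [RCLike.re_to_complex] at h3
  rw [← h3]
  refine integral_congr_ae (.of_forall fun x => ?_)
  simp only [stableDensity]
  rw [← Complex.re_ofReal_mul]
  push_cast
  rfl

lemma integrableOn_id_mul_exp_neg {l : ℝ} (hl : 0 < l) :
    IntegrableOn (fun x : ℝ => x * Real.exp (-l * x)) (Ioi 0) := by
  have := integrableOn_rpow_mul_exp_neg_mul_rpow (p := 1) (s := 1) (by norm_num) one_pos hl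
  simpa using this

/-- The Laplace transform of `x * s x`, by differentiation of that of `s`. -/
lemma laplace_id_mul_stableDensity (hγ : 1 < γ) {l : ℝ} (hl : 0 < l) :
    IntegrableOn (fun x => Real.exp (-l * x) * (x * stableDensity γ x)) (Ioi 0) ∧
    ∫ x in Ioi (0 : ℝ), Real.exp (-l * x) * (x * stableDensity γ x)
      = (γ - 1) * l ^ ((γ - 1) / γ - 1) * Real.exp (-γ * l ^ ((γ - 1) / γ)) := by
  obtain ⟨K, hK⟩ := exists_abs_stableDensity_le hγ
  have hcont := continuous_stableDensity hγ
  have hl2 : 0 < l / 2 := half_pos hl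
  have h := hasDerivAt_integral_of_dominated_loc_of_deriv_le (μ := volume.restrict (Ioi (0 : ℝ)))
    (F := fun m x => Real.exp (-m * x) * stableDensity γ x)
    (F' := fun m x => -(Real.exp (-m * x) * (x * stableDensity γ x)))
    (bound := fun x => x * Real.exp (-(l / 2) * x) * K)
    (Ioi_mem_nhds (show l / 2 < l by linarith))
    (.of_forall fun m => by fun_prop) (integrableOn_exp_mul_stableDensity hγ hl)
    (by fun_prop) ?_ ((integrableOn_id_mul_exp_neg hl2).mul_const K) ?_
  · refine ⟨by simpa [IntegrableOn] using h.1.neg, ?_⟩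
    have hd : HasDerivAt (fun m : ℝ => Real.exp (-γ * m ^ ((γ - 1) / γ)))
        (Real.exp (-γ * l ^ ((γ - 1) / γ)) *
          (-γ * ((γ - 1) / γ * l ^ ((γ - 1) / γ - 1)))) l :=
      ((Real.hasDerivAt_rpow_const (Or.inl hl.ne')).const_mul (-γ)).exp
    have h2 := h.2.congr_of_eventuallyEq (f₁ := fun m : ℝ => Real.exp (-γ * m ^ ((γ - 1) / γ))) (by
      filter_upwards [Ioi_mem_nhds hl] with m hm
      exact (laplace_stableDensity hγ hm).symm)
    have h3 := h2.unique hd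
    rw [integral_neg] at h3
    rw [← neg_eq_iff_eq_neg.2 h3.symm]
    field_simp
  · filter_upwards [ae_restrict_mem measurableSet_Ioi] with x hx m hm
    have hx : 0 < x := hx
    have hm : l / 2 < m := hm
    rw [norm_neg, norm_mul, norm_mul, Real.norm_of_nonneg (Real.exp_pos _).le,
      Real.norm_of_nonneg hx.le]
    calc _ = x * Real.exp (-m * x) * ‖stableDensity γ x‖ := by ring
      _ ≤ _ := by
        gcongr
        exact hK x
  · refine .of_forall fun x m _ => ?_
    have h1 : HasDerivAt (fun m : ℝ => -m * x) (-x) m := by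
      simpa using (hasDerivAt_id m).neg.mul_const x
    exact (h1.exp.mul_const (stableDensity γ x)).congr_deriv (by ring)

/-- The fractional integral equation satisfied by the stable density: the Laplace transform of
`x * s x` is `γ - 1` times that of `s` times `l ^ (α - 1)`, and `l ^ (α - 1)` is the Laplace
transform of `x ^ (-α) / Γ(1 - α)`, where `α = (γ - 1) / γ`. -/
lemma ae_id_mul_stableDensity_eq (hγ : 1 < γ) : ∀ᵐ x ∂volume.restrict (Ioi (0 : ℝ)),
    x * stableDensity γ x = (γ - 1) / Real.Gamma (1 - (γ - 1) / γ) *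
      ∫ t in (0 : ℝ)..x, stableDensity γ t * (x - t) ^ (-((γ - 1) / γ)) := by
  set α := (γ - 1) / γ with hα
  have h0 : 0 < α := stableExponent_pos hγ
  have h1 : α < 1 := stableExponent_lt_one hγ
  have hG : 0 < Real.Gamma (1 - α) := Real.Gamma_pos_of_pos (by linarith)
  have hkint : ∀ l : ℝ, 0 < l →
      IntegrableOn (fun x : ℝ => Real.exp (-l * x) * x ^ (-α)) (Ioi 0) := by
    intro l hl
    have := integrableOn_rpow_mul_exp_neg_mul_rpow (p := 1) (s := -α) (by linarith) one_pos hl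
    simpa [mul_comm] using this
  have hkval : ∀ l : ℝ, 0 < l → ∫ x in Ioi (0 : ℝ), Real.exp (-l * x) * x ^ (-α)
      = l ^ (α - 1) * Real.Gamma (1 - α) := by
    intro l hl
    have := Real.integral_rpow_mul_exp_neg_mul_Ioi (a := 1 - α) (by linarith) hl
    rw [one_div, Real.inv_rpow hl.le, ← Real.rpow_neg hl.le, neg_sub,
      show 1 - α - 1 = -α by ring] at this
    rw [← this]
    refine integral_congr_ae (.of_forall fun x => ?_)
    simp only
    rw [mul_comm, neg_mul]
  have hconv : ∀ l x : ℝ, ∫ t in (0 : ℝ)..x, ContinuousLinearMap.mul ℝ ℝ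
      (Real.exp (-l * t) * stableDensity γ t) (Real.exp (-l * (x - t)) * (x - t) ^ (-α))
      = Real.exp (-l * x) * ∫ t in (0 : ℝ)..x, stableDensity γ t * (x - t) ^ (-α) := by
    intro l x
    rw [← intervalIntegral.integral_const_mul]
    refine intervalIntegral.integral_congr fun t _ => ?_
    simp only [ContinuousLinearMap.mul_apply']
    rw [show -l * x = -l * t + -l * (x - t) by ring, Real.exp_add]
    ring
  have hcint : ∀ l : ℝ, 0 < l → IntegrableOn (fun x : ℝ => Real.exp (-l * x) *
      ∫ t in (0 : ℝ)..x, stableDensity γ t * (x - t) ^ (-α)) (Ioi 0) := by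
    intro l hl
    have := integrable_posConvolution (integrableOn_exp_mul_stableDensity hγ hl) (hkint l hl)
      (ContinuousLinearMap.mul ℝ ℝ)
    rw [posConvolution, integrable_indicator_iff measurableSet_Ioi] at this
    simpa only [hconv] using this
  have hcval : ∀ l : ℝ, 0 < l → ∫ x in Ioi (0 : ℝ), Real.exp (-l * x) *
      ∫ t in (0 : ℝ)..x, stableDensity γ t * (x - t) ^ (-α)
      = Real.exp (-γ * l ^ α) * (l ^ (α - 1) * Real.Gamma (1 - α)) := by
    intro l hl
    have := integral_posConvolution (integrableOn_exp_mul_stableDensity hγ hl) (hkint l hl)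
      (ContinuousLinearMap.mul ℝ ℝ)
    rw [hkval l hl, laplace_stableDensity hγ hl] at this
    simp only [hconv] at this
    rw [this, ContinuousLinearMap.mul_apply']
  have key := ae_eq_zero_of_laplace_eq_zero (D := fun x => x * stableDensity γ x -
    (γ - 1) / Real.Gamma (1 - α) *
      ∫ t in (0 : ℝ)..x, stableDensity γ t * (x - t) ^ (-α)) ?_ ?_
  · filter_upwards [key] with x hx
    exact sub_eq_zero.1 hx
  · simp only [mul_sub, mul_left_comm (Real.exp _) ((γ - 1) / Real.Gamma (1 - α))]
    have := (laplace_id_mul_stableDensity hγ one_pos).1.sub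
      ((hcint 1 one_pos).const_mul ((γ - 1) / Real.Gamma (1 - α)))
    simpa [Pi.sub_def] using this
  · intro l hl
    have hl0 : 0 < l := by linarith
    simp only [mul_sub, mul_left_comm (Real.exp _) ((γ - 1) / Real.Gamma (1 - α))]
    rw [integral_sub (laplace_id_mul_stableDensity hγ hl0).1
      ((hcint l hl0).const_mul ((γ - 1) / Real.Gamma (1 - α))), integral_const_mul, hcval l hl0,
      (laplace_id_mul_stableDensity hγ hl0).2, ← hα]
    field_simp
    ring

/-- The density is positive near `0` by its expansion. To the left of a first zero `x₀`, its
fractional integral would be bounded below by the contribution of `(0, x₀ / 2)`. -/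
lemma stableDensity_pos (hγ : 1 < γ) {x : ℝ} (hx : 0 < x) : 0 < stableDensity γ x := by
  set s := stableDensity γ with hs
  set α := (γ - 1) / γ with hα
  have h0 : 0 < α := stableExponent_pos hγ
  have h1 : α < 1 := stableExponent_lt_one hγ
  have hcont : Continuous s := continuous_stableDensity hγ
  obtain ⟨S, hS⟩ := exists_isZolotarevCoeff_stableDensity hγ
  have hnear : ∀ᶠ x in 𝓝[>] 0, 0 < s x :=
    eventually_nhdsGT_of_mul (k := γ - 1) (by linarith) (hS.2.eventually_pos hγ)
  obtain ⟨δ, hδ, hδs⟩ := mem_nhdsGT_iff_exists_Ioo_subset.1 hnear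
  have hδ : 0 < δ := hδ
  by_contra! hneg
  set Z := {y | δ ≤ y ∧ s y ≤ 0} with hZ
  have hxZ : x ∈ Z := ⟨not_lt.1 fun h => (hδs ⟨hx, h⟩ : 0 < s x).not_ge hneg, hneg⟩
  have hZc : IsClosed Z :=
    (isClosed_le continuous_const continuous_id).inter (isClosed_le hcont continuous_const)
  have hZb : BddBelow Z := ⟨δ, fun y hy => hy.1⟩
  set x₀ := sInf Z with hx₀
  have hx₀Z : x₀ ∈ Z := hZc.csInf_mem ⟨x, hxZ⟩ hZb
  have hx₀pos : 0 < x₀ := hδ.trans_le hx₀Z.1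
  have hpos : ∀ y, 0 < y → y < x₀ → 0 < s y := by
    intro y hy hyx
    by_contra! h
    exact (notMem_of_lt_csInf hyx hZb)
      ⟨not_lt.1 fun h' => (hδs ⟨hy, h'⟩ : 0 < s y).not_ge h, h⟩
  set m := ∫ t in (0 : ℝ)..(x₀ / 2), s t with hm
  have hmpos : 0 < m := intervalIntegral.intervalIntegral_pos_of_pos_on
    (hcont.intervalIntegrable _ _) (fun t ht => hpos t ht.1 (by linarith [ht.2])) (by linarith)
  set k := (γ - 1) / Real.Gamma (1 - α) with hk
  have hkpos : 0 < k := div_pos (by linarith) (Real.Gamma_pos_of_pos (by linarith))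
  set M := k * (x₀ ^ (-α) * m) / x₀ with hM
  have hMpos : 0 < M := by positivity
  have hae : ∀ᵐ y ∂volume.restrict (Ioo (x₀ / 2) x₀), M ≤ s y := by
    have hsub : Ioo (x₀ / 2) x₀ ⊆ Ioi 0 := fun y hy => (half_pos hx₀pos).trans hy.1
    filter_upwards [ae_restrict_of_ae_restrict_of_subset hsub (ae_id_mul_stableDensity_eq hγ),
      ae_restrict_mem measurableSet_Ioo] with y hy hyI
    have hy0 : 0 < y := hsub hyI
    have hint : IntervalIntegrable (fun t => s t * (y - t) ^ (-α)) volume 0 y := by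
      have h2 : IntervalIntegrable (fun t : ℝ => (y - t) ^ (-α)) volume 0 y := by
        have := (intervalIntegral.intervalIntegrable_rpow' (a := 0) (b := y)
          (show -1 < -α by linarith)).comp_sub_left y
        simpa using this.symm
      exact h2.continuousOn_mul hcont.continuousOn
    have hint2 : IntervalIntegrable (fun t => s t * (y - t) ^ (-α)) volume 0 (x₀ / 2) :=
      hint.mono_set (by
        rw [uIcc_of_le (by linarith), uIcc_of_le hy0.le]
        exact Icc_subset_Icc le_rfl hyI.1.le)
    have hlow : x₀ ^ (-α) * m ≤ ∫ t in (0 : ℝ)..y, s t * (y - t) ^ (-α) := by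
      calc x₀ ^ (-α) * m = ∫ t in (0 : ℝ)..(x₀ / 2), s t * x₀ ^ (-α) := by
            rw [intervalIntegral.integral_mul_const, mul_comm]
        _ ≤ ∫ t in (0 : ℝ)..(x₀ / 2), s t * (y - t) ^ (-α) := by
            refine intervalIntegral.integral_mono_on_of_le_Ioo (by linarith)
              ((hcont.intervalIntegrable _ _).mul_const _) hint2 fun t ht => ?_
            have h3 := (hpos t ht.1 (by linarith [ht.2])).le
            refine mul_le_mul_of_nonneg_left ?_ h3
            exact Real.rpow_le_rpow_of_nonpos (by linarith [ht.2, hyI.1])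
              (by linarith [ht.1, hyI.2]) (by linarith)
        _ ≤ _ := by
            refine intervalIntegral.integral_mono_interval le_rfl (by linarith) hyI.1.le ?_ hint
            filter_upwards [ae_restrict_mem measurableSet_Ioc,
              ae_restrict_of_ae (Measure.ae_ne volume y)] with t ht hty
            have hlt : t < y := lt_of_le_of_ne ht.2 hty
            exact mul_nonneg (hpos t ht.1 (hlt.trans hyI.2)).le
              (Real.rpow_nonneg (by linarith) _)
    have h4 : k * (x₀ ^ (-α) * m) ≤ y * s y := by
      rw [hy]
      exact mul_le_mul_of_nonneg_left hlow hkpos.le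
    rw [hM, div_le_iff₀ hx₀pos]
    nlinarith [hpos y hy0 hyI.2, hyI.2]
  -- by continuity, the almost everywhere bound holds everywhere
  have heq : EqOn (fun y => max M (s y)) s (Ioo (x₀ / 2) x₀) := by
    refine Measure.eqOn_open_of_ae_eq (μ := volume) ?_ isOpen_Ioo
      (continuous_const.max hcont).continuousOn hcont.continuousOn
    filter_upwards [hae] with y hy using max_eq_right hy
  have hlim : M ≤ s x₀ := by
    refine ge_of_tendsto (hcont.continuousAt.tendsto.mono_left nhdsWithin_le_nhds :
      Tendsto s (𝓝[<] x₀) (𝓝 (s x₀))) ?_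
    filter_upwards [Ioo_mem_nhdsLT (show x₀ / 2 < x₀ by linarith)] with y hy
    exact max_eq_right_iff.1 (heq hy)
  linarith [hx₀Z.2]

/-- The total mass is obtained from the Laplace transform by letting the parameter tend to `0`. -/
lemma isStableDensity_stableDensity (hγ : 1 < γ) : IsStableDensity γ (stableDensity γ) := by
  have hcont := continuous_stableDensity hγ
  have hα := stableExponent_pos hγ
  have hpt : ∀ l : ℝ, 0 < l →
      ∫⁻ x in Ioi (0 : ℝ), ENNReal.ofReal (Real.exp (-l * x) * stableDensity γ x)
        = ENNReal.ofReal (Real.exp (-γ * l ^ ((γ - 1) / γ))) := by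
    intro l hl
    rw [← ofReal_integral_eq_lintegral_ofReal (integrableOn_exp_mul_stableDensity hγ hl),
      laplace_stableDensity hγ hl]
    filter_upwards [ae_restrict_mem measurableSet_Ioi] with x hx
    exact mul_nonneg (Real.exp_pos _).le (stableDensity_pos hγ hx).le
  have hpos : ∀ n : ℕ, (0 : ℝ) < 1 / (n + 1) := fun n => by positivity
  have ht := lintegral_tendsto_of_tendsto_of_monotone (μ := volume.restrict (Ioi (0 : ℝ)))
    (f := fun (n : ℕ) x => ENNReal.ofReal (Real.exp (-(1 / (n + 1) : ℝ) * x) * stableDensity γ x))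
    (F := fun x => ENNReal.ofReal (stableDensity γ x)) (fun n => by fun_prop) ?_ ?_
  · simp only [hpt _ (hpos _)] at ht
    have ht2 : Tendsto (fun n : ℕ => ENNReal.ofReal
        (Real.exp (-γ * (1 / (n + 1) : ℝ) ^ ((γ - 1) / γ)))) atTop (𝓝 (ENNReal.ofReal 1)) := by
      refine ENNReal.tendsto_ofReal ?_
      have hc : ContinuousAt (fun l : ℝ => Real.exp (-γ * l ^ ((γ - 1) / γ))) 0 :=
        ((Real.continuousAt_rpow_const 0 _ (Or.inr hα.le)).const_mul _).rexp
      have := hc.tendsto.comp (tendsto_one_div_add_atTop_nhds_zero_nat (𝕜 := ℝ))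
      simpa [Real.zero_rpow hα.ne', Function.comp_def] using this
    have hmass := tendsto_nhds_unique ht ht2
    have hnn : 0 ≤ᵐ[volume.restrict (Ioi (0 : ℝ))] stableDensity γ := by
      filter_upwards [ae_restrict_mem measurableSet_Ioi] with x hx
      exact (stableDensity_pos hγ hx).le
    refine ⟨hcont.continuousOn, fun x hx => stableDensity_pos hγ hx, ?_, fun l hl => ?_⟩
    · refine ⟨hcont.aestronglyMeasurable, ?_⟩
      rw [hasFiniteIntegral_iff_ofReal hnn, hmass]
      exact ENNReal.ofReal_lt_top
    · rcases hl.eq_or_lt with rfl | hl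
      · simp only [neg_zero, zero_mul, Real.exp_zero, one_mul, Real.zero_rpow hα.ne', mul_zero]
        rw [integral_eq_lintegral_of_nonneg_ae hnn hcont.aestronglyMeasurable, hmass]
        simp
      · exact laplace_stableDensity hγ hl
  · filter_upwards [ae_restrict_mem measurableSet_Ioi] with x hx
    have hx : 0 < x := hx
    intro n k hnk
    refine ENNReal.ofReal_le_ofReal ?_
    have : (1 : ℝ) / (k + 1) ≤ 1 / (n + 1) := Nat.one_div_le_one_div hnk
    have := (stableDensity_pos hγ hx).le
    gcongr
  · refine .of_forall fun x => ENNReal.tendsto_ofReal ?_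
    have hc : Continuous fun l : ℝ => Real.exp (-l * x) * stableDensity γ x := by fun_prop
    have := (hc.tendsto 0).comp (tendsto_one_div_add_atTop_nhds_zero_nat (𝕜 := ℝ))
    simpa [Function.comp_def] using this

end

/-! ### The function `θ`: integrability, continuity and Laplace transform -/

namespace IsStableDensity

variable {γ : ℝ} {s : ℝ → ℝ}

lemma eqOn_stableDensity (hγ : 1 < γ) (hs : IsStableDensity γ s) :
    EqOn s (stableDensity γ) (Ioi 0) :=
  (isStableDensity_stableDensity hγ).eqOn hs

lemma eventually_abs_le (hγ : 1 < γ) (hs : IsStableDensity γ s) :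
    ∀ᶠ x in 𝓝[>] 0, |s x| ≤ x ^ 2 := by
  obtain ⟨S, hS⟩ := exists_isZolotarevCoeff_stableDensity hγ
  filter_upwards [hS.2.eventually_abs_le hγ, self_mem_nhdsWithin] with x hx hx0
  rwa [hs.eqOn_stableDensity hγ hx0]

lemma integrableOn_div (hγ : 1 < γ) (hs : IsStableDensity γ s) :
    IntegrableOn (fun y => s y / y) (Ioi 0) := by
  obtain ⟨δ, hδ, hδs⟩ := mem_nhdsGT_iff_exists_Ioo_subset.1 (hs.eventually_abs_le hγ)
  have hδ : 0 < δ := hδ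
  have hc : ContinuousOn (fun y => s y / y) (Ioi 0) :=
    hs.continuousOn.div continuousOn_id fun y hy => (mem_Ioi.1 hy).ne'
  rw [← Ioo_union_Ici_eq_Ioi hδ, integrableOn_union]
  constructor
  · refine (integrableOn_const (C := δ) (by simp)).mono'
      ((hc.mono Ioo_subset_Ioi_self).aestronglyMeasurable measurableSet_Ioo) ?_
    filter_upwards [ae_restrict_mem measurableSet_Ioo] with y hy
    have h1 : |s y| ≤ y ^ 2 := hδs hy
    rw [norm_div, Real.norm_eq_abs, Real.norm_of_nonneg hy.1.le, div_le_iff₀ hy.1]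
    nlinarith [hy.1, hy.2]
  · have hsub : Ici δ ⊆ Ioi 0 := fun y hy => hδ.trans_le hy
    refine ((hs.integrableOn.mono_set hsub).div_const δ).mono'
      ((hc.mono hsub).aestronglyMeasurable measurableSet_Ici) ?_
    filter_upwards [ae_restrict_mem measurableSet_Ici] with y hy
    have hy0 : 0 < y := hsub hy
    rw [norm_div, Real.norm_of_nonneg (hs.pos y hy0).le, Real.norm_of_nonneg hy0.le]
    have := (hs.pos y hy0).le
    gcongr
    exact hy

lemma continuousOn_rpow_mul (hs : IsStableDensity γ s) (a : ℝ) :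
    ContinuousOn (fun y => y ^ a * s y) (Ioi 0) :=
  (continuousOn_id.rpow_const fun _ hy => Or.inl (mem_Ioi.1 hy).ne').mul hs.continuousOn

lemma integrableOn_rpow_mul (hγ : 1 < γ) (hs : IsStableDensity γ s) (x : ℝ) :
    IntegrableOn (fun y : ℝ => y ^ (1 / γ - 1) * s y) (Ioc 0 x) := by
  have hβ : 0 < 1 / γ := one_div_pos.2 (by linarith)
  refine (((hs.integrableOn_div hγ).mono_set Ioc_subset_Ioi_self).const_mul (x ^ (1 / γ))).mono'
    (((hs.continuousOn_rpow_mul _).mono Ioc_subset_Ioi_self).aestronglyMeasurable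
      measurableSet_Ioc) ?_
  filter_upwards [ae_restrict_mem measurableSet_Ioc] with y hy
  have hsy := (hs.pos y hy.1).le
  have hy0 := hy.1
  rw [Real.norm_of_nonneg (by positivity), Real.rpow_sub_one hy.1.ne', div_mul_eq_mul_div,
    mul_div_assoc]
  gcongr
  exact hy.2

lemma hasDerivAt_integral_rpow_mul (hγ : 1 < γ) (hs : IsStableDensity γ s) {x : ℝ} (hx : 0 < x) :
    HasDerivAt (fun x => ∫ y in Ioc 0 x, y ^ (1 / γ - 1) * s y) (x ^ (1 / γ - 1) * s x) x := by
  have hc := hs.continuousOn_rpow_mul (1 / γ - 1)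
  have h := intervalIntegral.integral_hasDerivAt_right (a := 0) (b := x)
    (f := fun y => y ^ (1 / γ - 1) * s y)
    ((intervalIntegrable_iff_integrableOn_Ioc_of_le hx.le).2 (hs.integrableOn_rpow_mul hγ x))
    (hc.stronglyMeasurableAtFilter isOpen_Ioi x hx) (hc.continuousAt (Ioi_mem_nhds hx))
  refine h.congr_of_eventuallyEq ?_
  filter_upwards [Ioi_mem_nhds hx] with z hz
  exact (intervalIntegral.integral_of_le (le_of_lt hz)).symm

lemma eventually_abs_stableTheta_le (hγ : 1 < γ) (hs : IsStableDensity γ s) :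
    ∀ᶠ x in 𝓝[>] 0, |stableTheta γ s x| ≤ ((γ - 1) + (γ - 1) / γ) * x := by
  obtain ⟨δ, hδ, hδs⟩ := mem_nhdsGT_iff_exists_Ioo_subset.1 (hs.eventually_abs_le hγ)
  filter_upwards [Ioo_mem_nhdsGT hδ] with x hx
  have hx0 : 0 < x := hx.1
  have hγ1 : 0 < γ - 1 := by linarith
  have hβ : 0 < 1 / γ := one_div_pos.2 (by linarith)
  have hsx : |s x| ≤ x ^ 2 := hδs hx
  have hI : ‖∫ y in Ioc 0 x, y ^ (1 / γ - 1) * s y‖ ≤ x ^ (1 / γ + 1) * x := by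
    have h1 := norm_setIntegral_le_of_norm_le_const (μ := volume) (s := Ioc 0 x)
      (f := fun y => y ^ (1 / γ - 1) * s y) (C := x ^ (1 / γ + 1)) (by simp) (fun y hy => by
        have hy0 := hy.1
        have h2 : |s y| ≤ y ^ 2 := hδs ⟨hy.1, hy.2.trans_lt hx.2⟩
        rw [norm_mul, Real.norm_of_nonneg (by positivity), Real.norm_eq_abs]
        calc y ^ (1 / γ - 1) * |s y| ≤ y ^ (1 / γ - 1) * y ^ 2 := by gcongr
          _ = y ^ (1 / γ + 1) := by
            rw [← Real.rpow_natCast, ← Real.rpow_add hy0]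
            norm_num
            ring_nf
          _ ≤ x ^ (1 / γ + 1) := by
            gcongr
            exact hy.2)
    simpa [Measure.real, hx0.le] using h1
  rw [stableTheta, if_pos hx0]
  refine (abs_sub _ _).trans ?_
  rw [add_mul]
  refine add_le_add ?_ ?_
  · rw [abs_mul, abs_of_pos (by positivity)]
    calc (γ - 1) * x⁻¹ * |s x| ≤ (γ - 1) * x⁻¹ * x ^ 2 := by gcongr
      _ = (γ - 1) * x := by field_simp
  · rw [abs_mul, abs_of_pos (by positivity)]
    calc _ ≤ (γ - 1) / γ * x ^ (-1 - 1 / γ) * (x ^ (1 / γ + 1) * x) := by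
          gcongr
          exact hI
      _ = (γ - 1) / γ * x * (x ^ (-1 - 1 / γ) * x ^ (1 / γ + 1)) := by ring
      _ = _ := by
          rw [← Real.rpow_add hx0, show -1 - 1 / γ + (1 / γ + 1) = 0 by ring, Real.rpow_zero,
            mul_one]

lemma continuousOn_stableTheta (hγ : 1 < γ) (hs : IsStableDensity γ s) :
    ContinuousOn (stableTheta γ s) (Ici 0) := by
  intro x hx
  rcases (mem_Ici.1 hx).eq_or_lt with rfl | hx0
  · rw [← Ioi_insert, continuousWithinAt_insert_self]
    have h0 : stableTheta γ s 0 = 0 := by simp [stableTheta]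
    rw [ContinuousWithinAt, h0]
    refine squeeze_zero_norm' (hs.eventually_abs_stableTheta_le hγ) ?_
    have : Continuous fun x : ℝ => ((γ - 1) + (γ - 1) / γ) * x := by fun_prop
    exact (this.tendsto' 0 0 (by simp)).mono_left nhdsWithin_le_nhds
  · have h1 : ContinuousAt (fun x => (γ - 1) * x⁻¹ * s x - (γ - 1) / γ * x ^ (-1 - 1 / γ) *
        ∫ y in Ioc 0 x, y ^ (1 / γ - 1) * s y) x :=
      ((continuousAt_const.mul (continuousAt_inv₀ hx0.ne')).mul
        (hs.continuousOn.continuousAt (Ioi_mem_nhds hx0))).sub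
        ((continuousAt_const.mul (Real.continuousAt_rpow_const _ _ (Or.inl hx0.ne'))).mul
          (hs.hasDerivAt_integral_rpow_mul hγ hx0).continuousAt)
    refine (h1.congr ?_).continuousWithinAt
    filter_upwards [Ioi_mem_nhds hx0] with z hz
    rw [stableTheta, if_pos (mem_Ioi.1 hz)]

lemma integrableOn_exp_mul_rpow {β l y : ℝ} (hβ : 0 < β) (hl : 0 ≤ l) (hy : 0 < y) :
    IntegrableOn (fun x : ℝ => Real.exp (-l * x) * x ^ (-1 - β)) (Ioi y) := by
  refine (integrableOn_Ioi_rpow_of_lt (show -1 - β < -1 by linarith) hy).bdd_mul (c := 1)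
    (by fun_prop) ?_
  filter_upwards [ae_restrict_mem measurableSet_Ioi] with x hx
  have : y < x := hx
  rw [Real.norm_of_nonneg (Real.exp_pos _).le, Real.exp_le_one_iff]
  nlinarith

lemma integral_exp_mul_rpow_le {β l y : ℝ} (hβ : 0 < β) (hl : 0 ≤ l) (hy : 0 < y) :
    ∫ x in Ioi y, Real.exp (-l * x) * x ^ (-1 - β) ≤ y ^ (-β) / β := by
  have h := integral_Ioi_rpow_of_lt (show -1 - β < -1 by linarith) hy
  rw [show -1 - β + 1 = -β by ring, neg_div_neg_eq] at h
  rw [← h]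
  refine setIntegral_mono_on (integrableOn_exp_mul_rpow hβ hl hy)
    (integrableOn_Ioi_rpow_of_lt (by linarith) hy) measurableSet_Ioi fun x hx => ?_
  have hx0 : 0 < x := hy.trans hx
  refine mul_le_of_le_one_left (by positivity) ?_
  rw [Real.exp_le_one_iff]
  nlinarith

/-- Tonelli's theorem for the integral term of `θ`, on the region `0 < y < x`. -/
lemma laplace_integral_rpow_mul (hγ : 1 < γ) (hs : IsStableDensity γ s) {l : ℝ} (hl : 0 ≤ l) :
    IntegrableOn (fun x : ℝ => Real.exp (-l * x) * (x ^ (-1 - 1 / γ) *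
      ∫ y in Ioc 0 x, y ^ (1 / γ - 1) * s y)) (Ioi 0) ∧
    IntegrableOn (fun y : ℝ => (∫ x in Ioi y, Real.exp (-l * x) * x ^ (-1 - 1 / γ)) *
      (y ^ (1 / γ - 1) * s y)) (Ioi 0) ∧
    ∫ x in Ioi (0 : ℝ), Real.exp (-l * x) * (x ^ (-1 - 1 / γ) *
      ∫ y in Ioc 0 x, y ^ (1 / γ - 1) * s y)
      = ∫ y in Ioi (0 : ℝ), (∫ x in Ioi y, Real.exp (-l * x) * x ^ (-1 - 1 / γ)) *
        (y ^ (1 / γ - 1) * s y) := by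
  have hβ : 0 < 1 / γ := one_div_pos.2 (by linarith)
  set β := 1 / γ with hβdef
  set μ := volume.restrict (Ioi (0 : ℝ)) with hμ
  set f : ℝ → ℝ → ℝ := fun x y => {p : ℝ × ℝ | p.2 < p.1}.indicator
    (fun p : ℝ × ℝ => Real.exp (-l * p.1) * p.1 ^ (-1 - β) * (p.2 ^ (β - 1) * s p.2)) (x, y) with hf
  have hmeas : AEStronglyMeasurable (Function.uncurry f) (μ.prod μ) := by
    refine AEStronglyMeasurable.indicator ?_ (measurableSet_lt measurable_snd measurable_fst)
    have h1 : AEStronglyMeasurable (fun y => y ^ (β - 1) * s y) μ :=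
      (hs.continuousOn_rpow_mul _).aestronglyMeasurable measurableSet_Ioi
    have h2 : Measurable fun x : ℝ => Real.exp (-l * x) * x ^ (-1 - β) := by fun_prop
    exact (h2.aestronglyMeasurable.comp_fst (ν := μ)).mul (h1.comp_snd (μ := μ))
  have hfy : ∀ y : ℝ, (fun x => f x y) = (Ioi y).indicator
      (fun x => Real.exp (-l * x) * x ^ (-1 - β) * (y ^ (β - 1) * s y)) := by
    intro y
    ext x
    simp only [hf, indicator, mem_ofPred_eq, mem_Ioi]
  have hfx : ∀ x : ℝ, (fun y => f x y) = (Iio x).indicator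
      (fun y => Real.exp (-l * x) * x ^ (-1 - β) * (y ^ (β - 1) * s y)) := by
    intro x
    ext y
    simp only [hf, indicator, mem_ofPred_eq, mem_Iio]
  have hrest : ∀ y : ℝ, 0 < y → μ.restrict (Ioi y) = volume.restrict (Ioi y) := by
    intro y hy
    rw [hμ, Measure.restrict_restrict measurableSet_Ioi,
      inter_eq_left.2 (Ioi_subset_Ioi hy.le)]
  have hinner : ∀ y : ℝ, 0 < y → ∫ x, f x y ∂μ
      = (∫ x in Ioi y, Real.exp (-l * x) * x ^ (-1 - β)) * (y ^ (β - 1) * s y) := by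
    intro y hy
    rw [hfy, integral_indicator measurableSet_Ioi, hrest y hy, integral_mul_const]
  have hnonneg : ∀ x y : ℝ, 0 < x → 0 < y → 0 ≤ f x y := by
    intro x y hx hy
    refine indicator_apply_nonneg fun _ => ?_
    have := (hs.pos y hy).le
    simp only
    positivity
  have hinner_norm : ∀ y : ℝ, 0 < y → ∫ x, ‖f x y‖ ∂μ = ∫ x, f x y ∂μ := by
    intro y hy
    refine integral_congr_ae ?_
    filter_upwards [ae_restrict_mem measurableSet_Ioi] with x hx
    exact Real.norm_of_nonneg (hnonneg x y hx hy)
  have hint : Integrable (Function.uncurry f) (μ.prod μ) := by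
    rw [integrable_prod_iff' hmeas]
    constructor
    · filter_upwards [ae_restrict_mem measurableSet_Ioi] with y hy
      have hy : 0 < y := hy
      change Integrable (fun x => f x y) μ
      rw [hfy, integrable_indicator_iff measurableSet_Ioi, IntegrableOn, hrest y hy]
      exact (integrableOn_exp_mul_rpow hβ hl hy).mul_const _
    · refine ((hs.integrableOn_div hγ).div_const β).mono' ?_ ?_
      · exact hmeas.norm.prod_swap.integral_prod_right'
      · filter_upwards [ae_restrict_mem measurableSet_Ioi] with y hy
        have hy : 0 < y := hy
        change ‖∫ x, ‖f x y‖ ∂μ‖ ≤ _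
        have hsy := (hs.pos y hy).le
        rw [Real.norm_of_nonneg (integral_nonneg fun _ => norm_nonneg _), hinner_norm y hy,
          hinner y hy]
        calc _ ≤ y ^ (-β) / β * (y ^ (β - 1) * s y) := by
              gcongr
              exact integral_exp_mul_rpow_le hβ hl hy
          _ = (y ^ (-β) * y ^ (β - 1)) * s y / β := by ring
          _ = _ := by
              rw [← Real.rpow_add hy, show -β + (β - 1) = -1 by ring, Real.rpow_neg_one]
              ring
  have houter : ∀ x : ℝ, 0 < x → ∫ y, f x y ∂μ
      = Real.exp (-l * x) * (x ^ (-1 - β) * ∫ y in Ioc 0 x, y ^ (β - 1) * s y) := by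
    intro x hx
    rw [hfx, integral_indicator measurableSet_Iio, hμ, Measure.restrict_restrict measurableSet_Iio,
      inter_comm, Ioi_inter_Iio, integral_const_mul, integral_Ioc_eq_integral_Ioo, mul_assoc]
  refine ⟨?_, ?_, ?_⟩
  · refine (hint.integral_prod_left).congr ?_
    filter_upwards [ae_restrict_mem measurableSet_Ioi] with x hx
    exact houter x hx
  · refine (hint.integral_prod_right).congr ?_
    filter_upwards [ae_restrict_mem measurableSet_Ioi] with y hy
    exact hinner y hy
  · rw [← setIntegral_congr_fun measurableSet_Ioi fun x hx => houter x hx,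
      ← setIntegral_congr_fun measurableSet_Ioi fun y hy => hinner y hy]
    exact integral_integral_swap hint

lemma integrableOn_exp_mul_div (hγ : 1 < γ) (hs : IsStableDensity γ s) {l : ℝ} (hl : 0 ≤ l) :
    IntegrableOn (fun y => Real.exp (-l * y) * (s y / y)) (Ioi 0) := by
  refine (hs.integrableOn_div hγ).bdd_mul (c := 1) (by fun_prop) ?_
  filter_upwards [ae_restrict_mem measurableSet_Ioi] with x hx
  have : 0 < x := hx
  rw [Real.norm_of_nonneg (Real.exp_pos _).le, Real.exp_le_one_iff]
  nlinarith

lemma integral_exp_mul_stableTheta (hγ : 1 < γ) (hs : IsStableDensity γ s) {l : ℝ} (hl : 0 ≤ l) :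
    IntegrableOn (fun x => Real.exp (-l * x) * stableTheta γ s x) (Ioi 0) ∧
    ∫ x in Ioi (0 : ℝ), Real.exp (-l * x) * stableTheta γ s x
      = (γ - 1) * ∫ y in Ioi (0 : ℝ), (Real.exp (-l * y) * (s y / y) -
        1 / γ * (∫ x in Ioi y, Real.exp (-l * x) * x ^ (-1 - 1 / γ)) *
          (y ^ (1 / γ - 1) * s y)) := by
  obtain ⟨h1, h2, h3⟩ := hs.laplace_integral_rpow_mul hγ hl
  have h4 := hs.integrableOn_exp_mul_div hγ hl
  have he : EqOn (fun x => (γ - 1) * (Real.exp (-l * x) * (s x / x)) - (γ - 1) / γ *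
      (Real.exp (-l * x) * (x ^ (-1 - 1 / γ) * ∫ y in Ioc 0 x, y ^ (1 / γ - 1) * s y)))
      (fun x => Real.exp (-l * x) * stableTheta γ s x) (Ioi 0) := by
    intro x hx
    simp only
    rw [stableTheta, if_pos (mem_Ioi.1 hx)]
    ring
  refine ⟨IntegrableOn.congr_fun (Integrable.sub (h4.const_mul (γ - 1))
    (h1.const_mul ((γ - 1) / γ))) he measurableSet_Ioi, ?_⟩
  rw [← setIntegral_congr_fun measurableSet_Ioi he, integral_sub (h4.const_mul _)
    (h1.const_mul _), integral_const_mul, integral_const_mul, h3]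
  simp_rw [mul_assoc (1 / γ)]
  rw [integral_sub h4 (h2.const_mul _), integral_const_mul]
  ring

lemma integral_rpow_mul_exp_neg_mul_rpow_Ioi_one {α c : ℝ} (hα : 0 < α) (hc : 0 < c) :
    IntegrableOn (fun v : ℝ => v ^ (α - 1) * Real.exp (-c * v ^ α)) (Ioi 1) ∧
    ∫ v in Ioi (1 : ℝ), v ^ (α - 1) * Real.exp (-c * v ^ α) = Real.exp (-c) / (α * c) := by
  have hd : ∀ v ∈ Ici (1 : ℝ), HasDerivAt (fun v : ℝ => -(Real.exp (-c * v ^ α) / (α * c)))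
      (v ^ (α - 1) * Real.exp (-c * v ^ α)) v := by
    intro v hv
    have hv0 : 0 < v := zero_lt_one.trans_le hv
    have h := (((Real.hasDerivAt_rpow_const (p := α)
      (Or.inl hv0.ne')).const_mul (-c)).exp.div_const (α * c)).neg
    refine h.congr_deriv ?_
    field_simp
  have hpos : ∀ v ∈ Ioi (1 : ℝ), 0 ≤ v ^ (α - 1) * Real.exp (-c * v ^ α) := by
    intro v hv
    have hv0 : 0 < v := zero_lt_one.trans hv
    positivity
  have ht : Tendsto (fun v : ℝ => -(Real.exp (-c * v ^ α) / (α * c))) atTop (𝓝 0) := by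
    simpa using ((tendsto_exp_neg_mul_rpow hc hα).div_const (α * c)).neg
  refine ⟨integrableOn_Ioi_deriv_of_nonneg' hd hpos ht, ?_⟩
  rw [integral_Ioi_of_hasDerivAt_of_nonneg' hd hpos ht]
  simp

/-- Integration by parts and rescaling of the incomplete Gamma integral. -/
lemma exp_sub_integral_exp_mul_rpow {β l y : ℝ} (hβ : 0 < β) (hl : 0 < l) (hy : 0 < y) :
    Real.exp (-l * y) / y - β * (∫ x in Ioi y, Real.exp (-l * x) * x ^ (-1 - β)) * y ^ (β - 1)
      = l * ∫ v in Ioi (1 : ℝ), v ^ (-β) * Real.exp (-(l * v) * y) := by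
  have hd : ∀ x ∈ Ici y, HasDerivAt (fun x : ℝ => -(Real.exp (-l * x) * x ^ (-β)))
      (l * (Real.exp (-l * x) * x ^ (-β)) + β * (Real.exp (-l * x) * x ^ (-1 - β))) x := by
    intro x hx
    have hx0 : 0 < x := hy.trans_le hx
    have h1 : HasDerivAt (fun x : ℝ => Real.exp (-l * x)) (Real.exp (-l * x) * -l) x := by
      simpa using ((hasDerivAt_id x).const_mul (-l)).exp
    have h := (h1.mul (Real.hasDerivAt_rpow_const (p := -β) (Or.inl hx0.ne'))).neg
    refine h.congr_deriv ?_
    rw [show -β - 1 = -1 - β by ring]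
    ring
  have i1 := integrableOn_exp_mul_rpow hβ hl.le hy
  have i2 : IntegrableOn (fun x : ℝ => Real.exp (-l * x) * x ^ (-β)) (Ioi y) := by
    refine (integrableOn_exp_mul_Ioi (a := -l) (by linarith) y).mul_bdd (c := y ^ (-β))
      (by fun_prop) ?_
    filter_upwards [ae_restrict_mem measurableSet_Ioi] with x hx
    have hxy : y < x := hx
    rw [Real.norm_of_nonneg (Real.rpow_nonneg (hy.trans hxy).le _)]
    exact Real.rpow_le_rpow_of_nonpos hy hxy.le (by linarith)
  have ht : Tendsto (fun x : ℝ => -(Real.exp (-l * x) * x ^ (-β))) atTop (𝓝 0) := by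
    have := (tendsto_rpow_mul_exp_neg_mul_atTop_nhds_zero (-β) l hl).neg
    simpa [mul_comm] using this
  have hparts := integral_Ioi_of_hasDerivAt_of_tendsto' hd
    ((i2.const_mul l).add (i1.const_mul β)) ht
  rw [integral_add (i2.const_mul l) (i1.const_mul β), integral_const_mul, integral_const_mul]
    at hparts
  have hscale := integral_comp_mul_left_Ioi' (fun x : ℝ => Real.exp (-l * x) * x ^ (-β)) 1 hy
  rw [mul_one] at hscale
  have hscale2 : ∫ x in Ioi (1 : ℝ), Real.exp (-l * (y * x)) * (y * x) ^ (-β)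
      = y ^ (-β) * ∫ v in Ioi (1 : ℝ), v ^ (-β) * Real.exp (-(l * v) * y) := by
    rw [← integral_const_mul]
    refine setIntegral_congr_fun measurableSet_Ioi fun v hv => ?_
    have hv0 : 0 < v := zero_lt_one.trans hv
    rw [Real.mul_rpow hy.le hv0.le]
    ring_nf
  rw [hscale2, smul_eq_mul] at hscale
  rw [← hscale] at hparts
  have e1 : y ^ (-β) * y ^ (β - 1) = 1 / y := by
    rw [← Real.rpow_add hy, show -β + (β - 1) = -1 by ring, Real.rpow_neg_one, one_div]
  have e2 : y * (1 / y) = 1 := by field_simp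
  set J := ∫ v in Ioi (1 : ℝ), v ^ (-β) * Real.exp (-(l * v) * y)
  linear_combination (-y ^ (β - 1)) * hparts + (y * l * J - Real.exp (-l * y)) * e1 + l * J * e2

/-- With `α = (γ - 1) / γ`, the transform equals `(γ - 1) * l` times the integral of
`v ^ (α - 1) * exp (-γ * (l * v) ^ α)` over `v > 1`, whose integrand has an elementary primitive.
The case `l = 0` is separate because the integration by parts needs decay of the exponential. -/
lemma laplace_stableTheta (hγ : 1 < γ) (hs : IsStableDensity γ s) {l : ℝ} (hl : 0 ≤ l) :
    ∫ x in Ioi (0 : ℝ), Real.exp (-l * x) * stableTheta γ s x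
      = l ^ (1 / γ) * Real.exp (-γ * l ^ ((γ - 1) / γ)) := by
  have hβ : 0 < 1 / γ := one_div_pos.2 (by linarith)
  have hα := stableExponent_pos hγ
  rw [(hs.integral_exp_mul_stableTheta hγ hl).2]
  rcases hl.eq_or_lt with rfl | hl
  · -- here the inner integral is `y ^ (-1/γ) * γ`, and the integrand vanishes identically
    rw [Real.zero_rpow hβ.ne', zero_mul, mul_eq_zero]
    right
    refine setIntegral_eq_zero_of_forall_eq_zero fun y hy => ?_
    have hy : 0 < y := hy
    have h := integral_Ioi_rpow_of_lt (show -1 - 1 / γ < -1 by linarith) hy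
    rw [show -1 - 1 / γ + 1 = -(1 / γ) by ring, neg_div_neg_eq] at h
    simp only [neg_zero, zero_mul, Real.exp_zero, one_mul]
    rw [h, mul_div_cancel₀ _ hβ.ne', ← mul_assoc, ← Real.rpow_add hy,
      show -(1 / γ) + (1 / γ - 1) = -1 by ring, Real.rpow_neg_one]
    ring
  set α := (γ - 1) / γ with hαdef
  have hβα : -(1 / γ) = α - 1 := by rw [hαdef]; field_simp; ring
  set μ := volume.restrict (Ioi (0 : ℝ)) with hμ
  set ν := volume.restrict (Ioi (1 : ℝ)) with hν
  have hlα : 0 < l ^ α := Real.rpow_pos_of_pos hl _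
  obtain ⟨g1, g2⟩ := integral_rpow_mul_exp_neg_mul_rpow_Ioi_one hα
    (mul_pos (show 0 < γ by linarith) hlα)
  set f : ℝ → ℝ → ℝ := fun y v => v ^ (α - 1) * Real.exp (-(l * v) * y) * s y with hf
  have hsm : AEStronglyMeasurable s μ := hs.continuousOn.aestronglyMeasurable measurableSet_Ioi
  have hmeas : AEStronglyMeasurable (Function.uncurry f) (μ.prod ν) := by
    have h2 : Measurable fun p : ℝ × ℝ => p.2 ^ (α - 1) * Real.exp (-(l * p.2) * p.1) := by fun_prop
    exact h2.aestronglyMeasurable.mul (hsm.comp_fst (ν := ν))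
  have hinner : ∀ v : ℝ, 1 < v → ∫ y, f y v ∂μ
      = v ^ (α - 1) * Real.exp (-(γ * l ^ α) * v ^ α) := by
    intro v hv
    have hv0 : 0 < v := zero_lt_one.trans hv
    simp only [hf, mul_assoc]
    rw [integral_const_mul, hs.laplace (l * v) (by positivity), ← hαdef, Real.mul_rpow hl.le hv0.le]
    ring_nf
  have hint : Integrable (Function.uncurry f) (μ.prod ν) := by
    rw [integrable_prod_iff' hmeas]
    constructor
    · filter_upwards [ae_restrict_mem measurableSet_Ioi] with v hv
      have hv0 : 0 < v := zero_lt_one.trans hv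
      change Integrable (fun y => v ^ (α - 1) * Real.exp (-(l * v) * y) * s y) μ
      refine Integrable.bdd_mul (c := v ^ (α - 1)) hs.integrableOn (by fun_prop) ?_
      filter_upwards [ae_restrict_mem measurableSet_Ioi] with y hy
      have hy : 0 < y := hy
      rw [Real.norm_of_nonneg (by positivity)]
      refine mul_le_of_le_one_right (by positivity) ?_
      rw [Real.exp_le_one_iff]
      have : 0 < l * v * y := by positivity
      linarith
    · refine g1.congr ?_
      filter_upwards [ae_restrict_mem measurableSet_Ioi] with v hv
      have hv0 : 0 < v := zero_lt_one.trans hv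
      rw [← hinner v hv]
      refine integral_congr_ae ?_
      filter_upwards [ae_restrict_mem measurableSet_Ioi] with y hy
      have := (hs.pos y hy).le
      exact (Real.norm_of_nonneg (show 0 ≤ f y v by simp only [hf]; positivity)).symm
  have hpt : ∀ y ∈ Ioi (0 : ℝ), Real.exp (-l * y) * (s y / y) -
      1 / γ * (∫ x in Ioi y, Real.exp (-l * x) * x ^ (-1 - 1 / γ)) * (y ^ (1 / γ - 1) * s y)
      = l * ∫ v, f y v ∂ν := by
    intro y hy
    have h := exp_sub_integral_exp_mul_rpow hβ hl (mem_Ioi.1 hy)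
    simp only [hf]
    rw [integral_mul_const, ← hβα]
    linear_combination s y * h
  rw [setIntegral_congr_fun measurableSet_Ioi hpt, integral_const_mul,
    integral_integral_swap hint, setIntegral_congr_fun measurableSet_Ioi fun v hv => hinner v hv,
    g2]
  have e1 : l ^ (1 / γ) * l ^ α = l := by
    rw [← Real.rpow_add hl, hαdef, show 1 / γ + (γ - 1) / γ = 1 by field_simp; ring, Real.rpow_one]
  have hγ0 : γ ≠ 0 := by linarith
  have hα' : α * γ = γ - 1 := by rw [hαdef]; field_simp
  have hγ1 : γ - 1 ≠ 0 := by linarith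
  rw [← mul_assoc α, hα']
  nth_rewrite 1 [← e1]
  rw [neg_mul]
  field_simp

lemma integrableOn_stableTheta (hγ : 1 < γ) (hs : IsStableDensity γ s) :
    IntegrableOn (stableTheta γ s) (Ioi 0) := by
  simpa using (hs.integral_exp_mul_stableTheta hγ le_rfl).1

end IsStableDensity

/-! ### The expansion of `θ` -/

lemma rpow_natCast_mul {x : ℝ} (hx : 0 ≤ x) (n : ℕ) (κ : ℝ) :
    x ^ ((n : ℝ) * κ) = (x ^ κ) ^ n := by
  rw [mul_comm, Real.rpow_mul hx, Real.rpow_natCast]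

/-- An expansion, as an eventual bound on the remainder in terms of powers of `x ^ (γ - 1)`. -/
lemma HasStableExpansion.exists_bound {γ p : ℝ} {f : ℝ → ℝ} {c : ℕ → ℝ}
    (h : HasStableExpansion γ p f c) (hc : c 0 = 1) {N : ℕ} (hN : 1 ≤ N) :
    ∃ M : ℝ, ∀ᶠ x in 𝓝[>] 0, |Real.sqrt (2 * Real.pi * (1 - 1 / γ)) * x ^ p *
      Real.exp (1 / x ^ (γ - 1)) * f ((γ - 1) * x)
        - ∑ n ∈ Finset.range N, c n * (x ^ (γ - 1)) ^ n| ≤ M * (x ^ (γ - 1)) ^ N := by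
  obtain ⟨M, hM⟩ := (h N hN).bound
  refine ⟨M, ?_⟩
  filter_upwards [hM, self_mem_nhdsWithin] with x hx hx0
  have hx0 : 0 < x := hx0
  rw [one_add_sum_Ico_eq hc _ _ hN, Real.norm_of_nonneg (Real.rpow_nonneg hx0.le _),
    Real.norm_eq_abs] at hx
  simpa only [rpow_natCast_mul hx0.le] using hx

lemma hasStableExpansion_of_bound {γ p : ℝ} {f : ℝ → ℝ} {c : ℕ → ℝ} (hc : c 0 = 1)
    (h : ∀ N : ℕ, ∃ M : ℝ, ∀ᶠ x in 𝓝[>] 0, |Real.sqrt (2 * Real.pi * (1 - 1 / γ)) * x ^ p *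
      Real.exp (1 / x ^ (γ - 1)) * f ((γ - 1) * x)
        - ∑ n ∈ Finset.range (N + 1), c n * (x ^ (γ - 1)) ^ n| ≤ M * (x ^ (γ - 1)) ^ (N + 1)) :
    HasStableExpansion γ p f c := by
  intro N hN
  obtain ⟨N, rfl⟩ := Nat.exists_eq_add_of_le' hN
  obtain ⟨M, hM⟩ := h N
  refine IsBigO.of_bound M ?_
  filter_upwards [hM, self_mem_nhdsWithin] with x hx hx0
  have hx0 : 0 < x := hx0
  rw [one_add_sum_Ico_eq hc _ _ hN, Real.norm_of_nonneg (Real.rpow_nonneg hx0.le _),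
    Real.norm_eq_abs]
  simpa only [rpow_natCast_mul hx0.le] using hx

lemma tendsto_rpow_nhdsGT_zero {κ : ℝ} (hκ : 0 < κ) :
    Tendsto (fun x : ℝ => x ^ κ) (𝓝[>] 0) (𝓝 0) := by
  have := (Real.continuousAt_rpow_const 0 κ (Or.inr hκ.le)).tendsto
  rw [Real.zero_rpow hκ.ne'] at this
  exact this.mono_left nhdsWithin_le_nhds

lemma IsZolotarevCoeff.unique {γ : ℝ} (hγ : 1 < γ) {s : ℝ → ℝ} {S T : ℕ → ℝ}
    (hS : IsZolotarevCoeff γ s S) (hT : IsZolotarevCoeff γ s T) : S = T := by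
  funext n
  induction n using Nat.strong_induction_on with
  | _ n ih =>
    obtain ⟨M, hM⟩ := hS.2.exists_bound hS.1 (N := n + 1) (by omega)
    obtain ⟨M', hM'⟩ := hT.2.exists_bound hT.1 (N := n + 1) (by omega)
    have hlim : Tendsto (fun x : ℝ => (M + M') * x ^ (γ - 1)) (𝓝[>] 0) (𝓝 0) := by
      simpa using (tendsto_rpow_nhdsGT_zero (show 0 < γ - 1 by linarith)).const_mul (M + M')
    have hle : |S n - T n| ≤ 0 := by
      refine ge_of_tendsto hlim ?_
      filter_upwards [hM, hM', self_mem_nhdsWithin] with x h1 h2 hx0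
      have hx0 : 0 < x := hx0
      have ht : 0 < (x ^ (γ - 1)) ^ n := by positivity
      rw [Finset.sum_range_succ] at h1 h2
      have hsum : ∑ k ∈ Finset.range n, S k * (x ^ (γ - 1)) ^ k
          = ∑ k ∈ Finset.range n, T k * (x ^ (γ - 1)) ^ k :=
        Finset.sum_congr rfl fun k hk => by rw [ih k (Finset.mem_range.1 hk)]
      rw [hsum] at h1
      rw [abs_le] at h1 h2
      have h3 : |(S n - T n) * (x ^ (γ - 1)) ^ n|
          ≤ ((M + M') * x ^ (γ - 1)) * (x ^ (γ - 1)) ^ n := by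
        rw [abs_le]
        constructor <;> rw [pow_succ] at h1 h2 <;> linarith [h1.1, h1.2, h2.1, h2.2]
      rw [abs_mul, abs_of_pos ht] at h3
      exact le_of_mul_le_mul_right h3 ht
    exact sub_eq_zero.1 (abs_nonpos_iff.1 hle)

/-- Comparison of two functions vanishing at `0+` through their derivatives. -/
lemma abs_le_of_abs_deriv_le {D D' G G' : ℝ → ℝ} {δ : ℝ}
    (hD : ∀ x ∈ Ioo 0 δ, HasDerivAt D (D' x) x) (hG : ∀ x ∈ Ioo 0 δ, HasDerivAt G (G' x) x)
    (hDG : ∀ x ∈ Ioo 0 δ, |D' x| ≤ G' x) (hD0 : Tendsto D (𝓝[>] 0) (𝓝 0))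
    (hG0 : Tendsto G (𝓝[>] 0) (𝓝 0)) {x : ℝ} (hx : x ∈ Ioo 0 δ) : |D x| ≤ G x := by
  have key : ∀ {H H' : ℝ → ℝ}, (∀ x ∈ Ioo 0 δ, HasDerivAt H (H' x) x) →
      (∀ x ∈ Ioo 0 δ, 0 ≤ H' x) → Tendsto H (𝓝[>] 0) (𝓝 0) → 0 ≤ H x := by
    intro H H' hH hH' hH0
    have hmono : MonotoneOn H (Ioo 0 δ) := by
      refine monotoneOn_of_deriv_nonneg (convex_Ioo 0 δ)
        (fun y hy => (hH y hy).continuousAt.continuousWithinAt) ?_ ?_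
      · rw [interior_Ioo]
        exact fun y hy => (hH y hy).differentiableAt.differentiableWithinAt
      · rw [interior_Ioo]
        exact fun y hy => (hH y hy).deriv ▸ hH' y hy
    refine le_of_tendsto hH0 ?_
    filter_upwards [Ioo_mem_nhdsGT hx.1] with y hy
    exact hmono ⟨hy.1, hy.2.trans hx.2⟩ hx hy.2.le
  rw [abs_le]
  have h1 := key (fun x hx => (hG x hx).fun_sub (hD x hx))
    (fun x hx => sub_nonneg.2 ((le_abs_self _).trans (hDG x hx))) (by simpa using hG0.sub hD0)
  have h2 := key (fun x hx => (hG x hx).fun_add (hD x hx))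
    (fun x hx => by linarith [neg_abs_le (D' x), hDG x hx]) (by simpa using hG0.add hD0)
  constructor <;> linarith

lemma hasDerivAt_rpow_mul_exp {κ a x : ℝ} (hx : 0 < x) :
    HasDerivAt (fun x : ℝ => x ^ a * Real.exp (-(1 / x ^ κ)))
      (x ^ (a - κ - 1) * Real.exp (-(1 / x ^ κ)) * (κ + a * x ^ κ)) x := by
  have h1 : HasDerivAt (fun x : ℝ => -(1 / x ^ κ)) (κ * x ^ (-κ - 1)) x := by
    have h := (Real.hasDerivAt_rpow_const (p := -κ) (Or.inl hx.ne')).neg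
    refine (h.congr_of_eventuallyEq ?_).congr_deriv (by ring)
    filter_upwards [Ioi_mem_nhds hx] with y hy
    simp [Real.rpow_neg (le_of_lt (mem_Ioi.1 hy))]
  refine ((Real.hasDerivAt_rpow_const (p := a) (Or.inl hx.ne')).mul h1.exp).congr_deriv ?_
  have e1 : x ^ (a - 1) = x ^ (a - κ - 1) * x ^ κ := by
    rw [← Real.rpow_add hx]; ring_nf
  have e2 : x ^ a * x ^ (-κ - 1) = x ^ (a - κ - 1) := by
    rw [← Real.rpow_add hx]; ring_nf
  rw [e1]
  linear_combination (κ * Real.exp (-(1 / x ^ κ))) * e2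

/-- The polynomial identity behind the recursion: the derivative of the partial sum of the
expansion of the primitive is the partial sum of the expansion of the integrand, up to one term. -/
lemma sum_recursion {κ q g t : ℝ} {w S : ℕ → ℝ} (h0 : κ * w 0 = S 0 / g)
    (hw : ∀ n, κ * w (n + 1) + (q + n * κ) * w n = S (n + 1) / g) (N : ℕ) :
    ∑ n ∈ Finset.range (N + 1), (w n * t ^ n) * (κ + (q + n * κ) * t)
      = (∑ n ∈ Finset.range (N + 1), S n * t ^ n) / g + (q + N * κ) * w N * t ^ (N + 1) := by
  induction N with
  | zero =>
    simp
    linear_combination h0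
  | succ N ih =>
    rw [Finset.sum_range_succ, ih, Finset.sum_range_succ (fun n => S n * t ^ n) (N + 1)]
    push_cast
    linear_combination t ^ (N + 1) * hw N

section

variable {γ : ℝ} {s : ℝ → ℝ}

/-- The normalised primitive `C (κ / γ) κ ^ (-1 - 1/γ) ∫_0^{κ x} y ^ (1/γ - 1) s y dy` with
`κ = γ - 1` and `C = (2π(1 - 1/γ))^{1/2}`. -/
noncomputable def stablePrimitive (γ : ℝ) (s : ℝ → ℝ) (x : ℝ) : ℝ :=
  Real.sqrt (2 * Real.pi * (1 - 1 / γ)) * ((γ - 1) / γ) * (γ - 1) ^ (-1 - 1 / γ) *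
    ∫ y in Ioc 0 ((γ - 1) * x), y ^ (1 / γ - 1) * s y

lemma hasDerivAt_stablePrimitive (hγ : 1 < γ) (hs : IsStableDensity γ s) {x : ℝ} (hx : 0 < x) :
    HasDerivAt (stablePrimitive γ s)
      (Real.sqrt (2 * Real.pi * (1 - 1 / γ)) / γ * x ^ (1 / γ - 1) * s ((γ - 1) * x)) x := by
  have hκ : 0 < γ - 1 := by linarith
  have h1 := hs.hasDerivAt_integral_rpow_mul hγ (mul_pos hκ hx)
  have h2 : HasDerivAt (fun x : ℝ => (γ - 1) * x) (γ - 1) x := by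
    simpa using (hasDerivAt_id x).const_mul (γ - 1)
  have h3 := (h1.comp x h2).const_mul
    (Real.sqrt (2 * Real.pi * (1 - 1 / γ)) * ((γ - 1) / γ) * (γ - 1) ^ (-1 - 1 / γ))
  refine h3.congr_deriv ?_
  rw [Real.mul_rpow hκ.le hx.le]
  have e : (γ - 1) ^ (-1 - 1 / γ) * (γ - 1) ^ (1 / γ - 1) * (γ - 1) * (γ - 1) = 1 := by
    rw [← Real.rpow_add hκ, show -1 - 1 / γ + (1 / γ - 1) = (-1) + (-1) by ring,
      Real.rpow_add hκ, Real.rpow_neg_one]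
    field_simp
  linear_combination (Real.sqrt (2 * Real.pi * (1 - 1 / γ)) / γ * x ^ (1 / γ - 1) *
    s ((γ - 1) * x)) * e

lemma tendsto_stablePrimitive (hγ : 1 < γ) (hs : IsStableDensity γ s) :
    Tendsto (stablePrimitive γ s) (𝓝[>] 0) (𝓝 0) := by
  have hκ : 0 < γ - 1 := by linarith
  have hi : IntegrableOn (fun y : ℝ => y ^ (1 / γ - 1) * s y) (Icc 0 1) :=
    (integrableOn_Icc_iff_integrableOn_Ioc enorm_ne_top).2 (hs.integrableOn_rpow_mul hγ 1)
  have hc := (intervalIntegral.continuousOn_primitive hi) 0 (by simp)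
  have h1 : Tendsto (fun x => ∫ y in Ioc 0 x, y ^ (1 / γ - 1) * s y) (𝓝[>] 0) (𝓝 0) := by
    have := hc.tendsto
    simp only [Ioc_self, Measure.restrict_empty, integral_zero_measure] at this
    refine this.mono_left ?_
    rw [nhdsWithin_le_iff]
    filter_upwards [Ioo_mem_nhdsGT zero_lt_one] with y hy using Ioo_subset_Icc_self hy
  have h2 := (h1.comp (tendsto_mul_nhdsGT_zero hκ)).const_mul
    (Real.sqrt (2 * Real.pi * (1 - 1 / γ)) * ((γ - 1) / γ) * (γ - 1) ^ (-1 - 1 / γ))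
  rw [mul_zero] at h2
  exact h2

/-- Termwise integration of the expansion of the density. -/
lemma stablePrimitive_expansion (hγ : 1 < γ) (hs : IsStableDensity γ s) {S w : ℕ → ℝ}
    (hS : IsZolotarevCoeff γ s S) (h0 : (γ - 1) * w 0 = S 0 / γ)
    (hw : ∀ n : ℕ, (γ - 1) * w (n + 1) + (1 / γ + (γ - 3) / 2 + n * (γ - 1)) * w n
      = S (n + 1) / γ) (N : ℕ) :
    ∃ K : ℝ, ∀ᶠ x in 𝓝[>] 0, |stablePrimitive γ s x - x ^ (1 / γ + (γ - 3) / 2) *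
        Real.exp (-(1 / x ^ (γ - 1))) * ∑ n ∈ Finset.range (N + 1), w n * (x ^ (γ - 1)) ^ n|
      ≤ K * (x ^ (1 / γ + (γ - 3) / 2) * Real.exp (-(1 / x ^ (γ - 1))) *
        (x ^ (γ - 1)) ^ (N + 1)) := by
  set κ := γ - 1 with hκdef
  have hκ : 0 < κ := by linarith
  set q := 1 / γ + (γ - 3) / 2 with hq
  set C := Real.sqrt (2 * Real.pi * (1 - 1 / γ)) with hC
  obtain ⟨M, hM⟩ := hS.2.exists_bound hS.1 (N := N + 1) (by omega)
  set L : ℝ := |M| / γ + |(q + N * κ) * w N| with hL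
  have hLnn : 0 ≤ L := by positivity
  set a : ℝ := q + (N + 1 : ℕ) * κ with ha
  -- the comparison function `x ^ a * exp (-x ^ (-κ))` is eventually increasing
  have hsmall : ∀ᶠ x in 𝓝[>] (0 : ℝ), κ / 2 ≤ κ + a * x ^ κ := by
    have h := ((tendsto_rpow_nhdsGT_zero hκ).const_mul a).const_add κ
    rw [mul_zero, add_zero] at h
    exact (h.eventually_const_lt (half_lt_self hκ)).mono fun x hx => hx.le
  obtain ⟨δ, hδ, hδs⟩ := mem_nhdsGT_iff_exists_Ioo_subset.1 (hM.and hsmall)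
  refine ⟨2 * L / κ, ?_⟩
  filter_upwards [Ioo_mem_nhdsGT hδ, self_mem_nhdsWithin] with x hx hx0
  have hx0 : 0 < x := hx0
  set P : ℝ → ℝ := fun x => ∑ n ∈ Finset.range (N + 1),
    w n * (x ^ (q + n * κ) * Real.exp (-(1 / x ^ κ))) with hP
  have hPd : ∀ y ∈ Ioo 0 δ, HasDerivAt P (∑ n ∈ Finset.range (N + 1),
      w n * (y ^ (q + n * κ - κ - 1) * Real.exp (-(1 / y ^ κ)) * (κ + (q + n * κ) * y ^ κ))) y :=
    fun y hy => HasDerivAt.fun_sum fun n _ => (hasDerivAt_rpow_mul_exp hy.1).const_mul _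
  have hP0 : Tendsto P (𝓝[>] 0) (𝓝 0) := by
    have := tendsto_finsetSum (Finset.range (N + 1)) fun n _ =>
      (tendsto_rpow_mul_exp_neg_one_div hκ (q + n * κ)).const_mul (w n)
    simp only [mul_zero, Finset.sum_const_zero] at this
    exact this
  have hsplit : ∀ y : ℝ, 0 < y → ∀ (b : ℝ) (n : ℕ), y ^ (b + n * κ) = y ^ b * (y ^ κ) ^ n := by
    intro y hy b n
    rw [Real.rpow_add hy, rpow_natCast_mul hy.le]
  have key := abs_le_of_abs_deriv_le (δ := δ)
    (D := fun x => stablePrimitive γ s x - P x)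
    (G := fun x => 2 * L / κ * (x ^ a * Real.exp (-(1 / x ^ κ))))
    (fun y hy => (hasDerivAt_stablePrimitive hγ hs hy.1).sub (hPd y hy))
    (fun y hy => (hasDerivAt_rpow_mul_exp hy.1).const_mul _) ?_
    (by simpa using (tendsto_stablePrimitive hγ hs).sub hP0)
    (by simpa using (tendsto_rpow_mul_exp_neg_one_div hκ a).const_mul (2 * L / κ)) hx
  · have e1 : P x = x ^ q * Real.exp (-(1 / x ^ κ)) *
        ∑ n ∈ Finset.range (N + 1), w n * (x ^ κ) ^ n := by
      rw [hP, Finset.mul_sum]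
      refine Finset.sum_congr rfl fun n _ => ?_
      rw [hsplit x hx0]
      ring
    have e2 : x ^ a * Real.exp (-(1 / x ^ κ))
        = x ^ q * Real.exp (-(1 / x ^ κ)) * (x ^ κ) ^ (N + 1) := by
      rw [ha, hsplit x hx0]
      ring
    simp only [e1, e2] at key
    exact key
  · intro y hy
    have hy0 : 0 < y := hy.1
    obtain ⟨hMy, hsy⟩ := hδs hy
    set t := y ^ κ with ht
    have ht0 : 0 < t := Real.rpow_pos_of_pos hy0 _
    set E := Real.exp (-(1 / t)) with hE
    set F := C * y ^ ((γ + 1) / 2) * Real.exp (1 / t) * s (κ * y) with hF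
    set Z := y ^ (q - κ - 1) * E with hZ
    have hZ0 : 0 < Z := by positivity
    have hEE : Real.exp (1 / t) * E = 1 := by rw [hE, ← Real.exp_add]; simp
    have hJ : C / γ * y ^ (1 / γ - 1) * s (κ * y) = Z * (F / γ) := by
      have e : y ^ (q - κ - 1) * y ^ ((γ + 1) / 2) = y ^ (1 / γ - 1) := by
        rw [← Real.rpow_add hy0, hq, hκdef]
        ring_nf
      rw [hZ, hF, ← e]
      linear_combination (-(C / γ * (y ^ (q - κ - 1) * y ^ ((γ + 1) / 2)) * s (κ * y))) * hEE
    have hPs : ∑ n ∈ Finset.range (N + 1),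
        w n * (y ^ (q + n * κ - κ - 1) * E * (κ + (q + n * κ) * t))
        = Z * ((∑ n ∈ Finset.range (N + 1), S n * t ^ n) / γ
          + (q + N * κ) * w N * t ^ (N + 1)) := by
      rw [← sum_recursion h0 hw N, Finset.mul_sum]
      refine Finset.sum_congr rfl fun n _ => ?_
      rw [show q + n * κ - κ - 1 = (q - κ - 1) + n * κ by ring, hsplit y hy0]
      ring
    have hbd : |F / γ - ((∑ n ∈ Finset.range (N + 1), S n * t ^ n) / γ
          + (q + N * κ) * w N * t ^ (N + 1))| ≤ L * t ^ (N + 1) := by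
      rw [← sub_sub, ← sub_div]
      refine (abs_sub _ _).trans ?_
      rw [hL, add_mul (|M| / γ), abs_div, abs_of_pos (show 0 < γ by linarith),
        abs_mul _ (t ^ (N + 1)),
        abs_of_pos (show 0 < t ^ (N + 1) by positivity), div_mul_eq_mul_div]
      have : M * t ^ (N + 1) ≤ |M| * t ^ (N + 1) := by
        gcongr
        exact le_abs_self M
      have h5 := hMy.trans this
      gcongr
    rw [hJ, hPs, ← mul_sub, abs_mul, abs_of_pos hZ0]
    have e3 : y ^ (a - κ - 1) = y ^ (q - κ - 1) * t ^ (N + 1) := by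
      rw [ha, show q + (N + 1 : ℕ) * κ - κ - 1 = (q - κ - 1) + (N + 1 : ℕ) * κ by ring,
        hsplit y hy0]
    rw [e3]
    calc Z * |F / γ - ((∑ n ∈ Finset.range (N + 1), S n * t ^ n) / γ
          + (q + N * κ) * w N * t ^ (N + 1))| ≤ Z * (L * t ^ (N + 1)) := by gcongr
      _ = 2 * L / κ * (Z * t ^ (N + 1) * (κ / 2)) := by field_simp
      _ ≤ 2 * L / κ * (Z * t ^ (N + 1) * (κ + a * t)) := by gcongr
      _ = _ := by rw [hZ]; ring

lemma hasStableExpansion_stableTheta (hγ : 1 < γ) (hs : IsStableDensity γ s) {S : ℕ → ℝ}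
    (hS : IsZolotarevCoeff γ s S) :
    HasStableExpansion γ ((γ + 3) / 2) (stableTheta γ s) (stableV γ S) := by
  set V := stableV γ S with hV
  -- the coefficients of the expansion of the primitive
  set w : ℕ → ℝ := fun n => S (n + 1) - V (n + 1) with hw
  have hκ : 0 < γ - 1 := by linarith
  have hγ0 : γ ≠ 0 := by linarith
  have hκ0 : γ - 1 ≠ 0 := hκ.ne'
  have hV0 : V 0 = 1 := rfl
  have hVs : ∀ n, V (n + 1) = S (n + 1) + ((n : ℝ) - 1 / 2 - 1 / (γ - 1)) * S n
      - ((n : ℝ) - 1 / 2 - 1 / γ) * V n := fun n => rfl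
  have hw0 : (γ - 1) * w 0 = S 0 / γ := by
    simp only [hw]
    rw [hVs 0, hV0, hS.1]
    field_simp
    push_cast
    ring
  have hws : ∀ n : ℕ, (γ - 1) * w (n + 1) + (1 / γ + (γ - 3) / 2 + n * (γ - 1)) * w n
      = S (n + 1) / γ := by
    intro n
    simp only [hw]
    rw [hVs (n + 1)]
    field_simp
    push_cast
    ring
  refine hasStableExpansion_of_bound hV0 fun N => ?_
  obtain ⟨M, hM⟩ := hS.2.exists_bound hS.1 (N := N + 1) (by omega)
  obtain ⟨K, hK⟩ := stablePrimitive_expansion hγ hs hS hw0 hws N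
  refine ⟨M + |w N| + |K|, ?_⟩
  filter_upwards [hM, hK, self_mem_nhdsWithin, (tendsto_rpow_nhdsGT_zero hκ).eventually_le_const
    one_pos] with x hx1 hx2 hx0 hxt
  have hx0 : 0 < x := hx0
  set t := x ^ (γ - 1) with ht
  have ht0 : 0 < t := Real.rpow_pos_of_pos hx0 _
  set C := Real.sqrt (2 * Real.pi * (1 - 1 / γ)) with hC
  set q := 1 / γ + (γ - 3) / 2 with hq
  set J := stablePrimitive γ s x with hJ
  set F := C * x ^ ((γ + 1) / 2) * Real.exp (1 / t) * s ((γ - 1) * x) with hF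
  set A := x ^ ((γ + 1) / 2 - 1 / γ) * Real.exp (1 / t) with hA
  have hA0 : 0 < A := by positivity
  have hAq : A * (x ^ q * Real.exp (-(1 / t))) = t := by
    have e1 : x ^ ((γ + 1) / 2 - 1 / γ) * x ^ q = t := by
      rw [← Real.rpow_add hx0, hq, ht]
      ring_nf
    have e2 : Real.exp (1 / t) * Real.exp (-(1 / t)) = 1 := by rw [← Real.exp_add]; simp
    rw [hA]
    linear_combination e1 + (x ^ ((γ + 1) / 2 - 1 / γ) * x ^ q) * e2
  have hθ : C * x ^ ((γ + 3) / 2) * Real.exp (1 / t) * stableTheta γ s ((γ - 1) * x)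
      = F - A * J := by
    have e1 : x ^ ((γ + 3) / 2) = x ^ ((γ + 1) / 2) * x := by
      rw [show (γ + 3) / 2 = (γ + 1) / 2 + 1 by ring, Real.rpow_add_one hx0.ne']
    have e2 : x ^ ((γ + 3) / 2) * x ^ (-1 - 1 / γ) = x ^ ((γ + 1) / 2 - 1 / γ) := by
      rw [← Real.rpow_add hx0]
      ring_nf
    have e3 : x * x⁻¹ = 1 := mul_inv_cancel₀ hx0.ne'
    have e4 : (γ - 1) * (γ - 1)⁻¹ = 1 := mul_inv_cancel₀ hκ0
    rw [stableTheta, if_pos (mul_pos hκ hx0), Real.mul_rpow hκ.le hx0.le, hJ, stablePrimitive, hA,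
      ← e2, hF, mul_inv, e1]
    linear_combination (C * x ^ ((γ + 1) / 2) * Real.exp (1 / t) * s ((γ - 1) * x)) *
      (e3 + x * x⁻¹ * e4)
  have hsum : ∑ n ∈ Finset.range (N + 1), V n * t ^ n
      = ∑ n ∈ Finset.range (N + 1), S n * t ^ n
        - t * ∑ n ∈ Finset.range (N + 1), w n * t ^ n + w N * t ^ (N + 1) := by
    rw [Finset.sum_range_succ (fun n => w n * t ^ n), Finset.sum_range_succ',
      Finset.sum_range_succ' (fun n => S n * t ^ n), hV0, hS.1, mul_add, Finset.mul_sum]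
    have : ∑ n ∈ Finset.range N, V (n + 1) * t ^ (n + 1)
        = ∑ n ∈ Finset.range N, S (n + 1) * t ^ (n + 1)
          - ∑ n ∈ Finset.range N, t * (w n * t ^ n) := by
      rw [← Finset.sum_sub_distrib]
      refine Finset.sum_congr rfl fun n _ => ?_
      simp only [hw]
      ring
    rw [this]
    ring
  set W := ∑ n ∈ Finset.range (N + 1), w n * t ^ n with hW
  have hAJ : |A * J - t * W| ≤ |K| * t ^ (N + 1) := by
    have e : A * J - t * W = A * (J - x ^ q * Real.exp (-(1 / t)) * W) := by
      linear_combination W * hAq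
    rw [e, abs_mul, abs_of_pos hA0]
    calc _ ≤ A * (K * (x ^ q * Real.exp (-(1 / t)) * t ^ (N + 1))) := by gcongr
      _ = K * (t * t ^ (N + 1)) := by linear_combination K * t ^ (N + 1) * hAq
      _ ≤ |K| * (1 * t ^ (N + 1)) := by
        gcongr
        exact le_abs_self K
      _ = _ := by ring
  rw [hθ, hsum]
  have e : F - A * J - (∑ n ∈ Finset.range (N + 1), S n * t ^ n - t * W + w N * t ^ (N + 1))
      = (F - ∑ n ∈ Finset.range (N + 1), S n * t ^ n) - (A * J - t * W) - w N * t ^ (N + 1) := by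
    ring
  rw [e]
  refine (abs_sub _ _).trans ((add_le_add_left (abs_sub _ _) _).trans ?_)
  rw [abs_mul (w N), abs_of_pos (show 0 < t ^ (N + 1) by positivity)]
  linarith

end

theorem proposition1p4 (γ : ℝ) (hγ₁ : 1 < γ) (hγ₂ : γ ≤ 2) :
    -- the density exists and is unique on `(0, ∞)`
    (∃ s : ℝ → ℝ, IsStableDensity γ s ∧
      ∀ t : ℝ → ℝ, IsStableDensity γ t → EqOn t s (Ioi 0)) ∧
    ∀ s : ℝ → ℝ, IsStableDensity γ s →
      -- (i) `θ` is well defined, continuous, integrable, with the stated Laplace transform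
      ((∀ x : ℝ, 0 < x → IntegrableOn (fun y : ℝ => y ^ (1 / γ - 1) * s y) (Ioc 0 x)) ∧
        ContinuousOn (stableTheta γ s) (Ici 0) ∧
        IntegrableOn (stableTheta γ s) (Ioi 0) ∧
        ∀ l : ℝ, 0 ≤ l →
          ∫ x in Ioi (0 : ℝ), Real.exp (-l * x) * stableTheta γ s x
            = l ^ (1 / γ) * Real.exp (-γ * l ^ ((γ - 1) / γ))) ∧
      -- (ii) Zolotarev's coefficients exist and are unique, and yield the expansion of `θ`
      (∃! S : ℕ → ℝ, IsZolotarevCoeff γ s S) ∧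
      ∀ S : ℕ → ℝ, IsZolotarevCoeff γ s S →
        HasStableExpansion γ ((γ + 3) / 2) (stableTheta γ s) (stableV γ S) := by
  refine ⟨⟨stableDensity γ, isStableDensity_stableDensity hγ₁, fun t ht =>
    (isStableDensity_stableDensity hγ₁).eqOn ht⟩, fun s hs => ⟨⟨fun x _ =>
    hs.integrableOn_rpow_mul hγ₁ x, hs.continuousOn_stableTheta hγ₁,
    hs.integrableOn_stableTheta hγ₁, fun l hl => hs.laplace_stableTheta hγ₁ hl⟩, ?_,
    fun S hS => hasStableExpansion_stableTheta hγ₁ hs hS⟩⟩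
  obtain ⟨S, hS0, hS⟩ := exists_isZolotarevCoeff_stableDensity hγ₁
  have hSs : IsZolotarevCoeff γ s S := by
    refine ⟨hS0, fun N hN => (hS N hN).congr' ?_ EventuallyEq.rfl⟩
    filter_upwards [self_mem_nhdsWithin] with x hx
    rw [hs.eqOn_stableDensity hγ₁ (mul_pos (show 0 < γ - 1 by linarith) (mem_Ioi.1 hx))]
  exact ⟨S, hSs, fun T hT => hT.unique hγ₁ hSs⟩
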